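/- Let $Z$ and $Y$ be complex Hilbert spaces, let $A:D(A)\subset Z\to Z$ generate a strongly continuous group $(e^{At})_{t\in\mathbb R}$ on $Z$, let $C\in\mathcal L(D(A),Y)$ be an admissible observation operator for $e^{At}$, let $F_1\in\mathcal L(Y,[D(A^*)]')$, and let $\mu>0$. Here $D(A)$ and $D(A^*)$ carry the graph norm, $[D(A^*)]'$ is the dual of $D(A^*)$ with respect to the pivot space $Z$, so that $Z\subset[D(A^*)]'$, and $\tilde A\in\mathcal L(Z,[D(A^*)]')$ is the extension of $A$ given by $\langle\tilde Ax,y\rangle=\langle x,A^*y\rangle_Z$ for $y\in D(A^*)$. The $\Lambda$-extension of $C$ with respect to $A$ is $C_\Lambda x=\lim_{s\to+\infty}Cs(s-A)^{-1}x$, with domain $D(C_\Lambda)$ the set of $x\in Z$ for which the limit exists. On $L^2([0,\mu];Y)$ let $G_\mu f=-f'$ with $D(G_\mu)=\{f\in H^1([0,\mu];Y): f(0)=0\}$, let $\tilde G_\mu:L^2([0,\mu];Y)\to[D(G_\mu^*)]'$ be the corresponding extension, let $B_\mu\in\mathcal L(Y,[D(G_\mu^*)]')$ be given by $\langle B_\mu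 y,f\rangle=\langle y,f(0)\rangle_Y$, and let $C_{\mu\Lambda}$ be the $\Lambda$-extension with respect to $G_\mu$ of $C_\mu f=f(\mu)$. Put $Z_{F_1}=\{z\in Z:\ \tilde Az+F_1y\in Z\text{ for some }y\in Y\}$. Then $\rho(A)\neq\emptyset$ and $Z_{F_1}=D(A)+(\lambda-\tilde A)^{-1}F_1Y$ for every $\lambda\in\rho(A)$. Suppose moreover that $Z_{F_1}\subset D(C_\Lambda)$. Then for every $z\in Z$ one has $e^{-Ax}z\in D(C_\Lambda)$ for almost every $x\in[0,\mu]$, the observability map $(\Psi_\mu z)(x)=-C_\Lambda e^{-Ax}z$ of $(-A,-C)$ is a bounded operator from $Z$ to $L^2([0,\mu];Y)$, and the linear operator $P_\mu:Z+F_1Y\subset[D(A^*)]'\to[D(G_\mu^*)]'$, $$P_\mu z=\big[B_\mu C_\Lambda+(\lambda-\tilde G_\mu)\Psi_\mu\big](\lambda-\tilde A)^{-1}z,\qquad z\in Z+F_1Y,\quad \lambda\in\rho(A),$$ is well defined and has the following properties. (i) $P_\mu$ does not depend on $\lambda\in\rho(A)$, and it extends $\Psi_\mu$: $P_\mu z=\Psi_\mu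 z$ for all $z\in Z$. (ii) For all $z\in Z_{F_1}$ one has $\tilde Az\in Z+F_1Y$, $P_\mu z\in L^2([0,\mu];Y)$ and $\tilde G_\mu P_\mu z-P_\mu\tilde Az=B_\mu C_\Lambda z$. (iii) For all $z\in D(A)$ one has $P_\mu z\in D(C_{\mu\Lambda})$, $e^{-A\mu}z\in D(C_\Lambda)$ and $C_{\mu\Lambda}P_\mu z=-C_\Lambda e^{-A\mu}z$; this defines an operator in $\mathcal L(D(A),Y)$. -/

import Mathlib

open MeasureTheory Filter Topology Set
open scoped ENNReal NNReal

set_option linter.unusedSectionVars false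

namespace DelaySylvester

noncomputable section

/-! ## Unbounded operators, the graph norm and resolvents -/

section Operators

variable {E F : Type*} [NormedAddCommGroup E] [InnerProductSpace ℂ E]
  [NormedAddCommGroup F] [InnerProductSpace ℂ F]

/-- The domain `D(A)` of an unbounded operator, regarded as a normed space with the graph norm
`(‖x‖² + ‖A x‖²)^(1/2)`. -/
def GraphDomain (A : E →ₗ.[ℂ] F) : Type _ := A.domain

instance (A : E →ₗ.[ℂ] F) : AddCommGroup (GraphDomain A) :=
  inferInstanceAs (AddCommGroup A.domain)

instance (A : E →ₗ.[ℂ] F) : Module ℂ (GraphDomain A) :=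
  inferInstanceAs (Module ℂ A.domain)

namespace GraphDomain

variable (A : E →ₗ.[ℂ] F)

/-- The map `x ↦ (x, A x)`. -/
def emb : GraphDomain A →ₗ[ℂ] WithLp 2 (E × F) :=
  (WithLp.linearEquiv 2 ℂ (E × F)).symm.toLinearMap ∘ₗ (A.domain.subtype.prod A.toFun)

lemma emb_injective : Function.Injective (emb A) := by
  intro x y h
  have h2 := congrArg (fun p : WithLp 2 (E × F) => p.fst) h
  exact Subtype.ext h2

instance : NormedAddCommGroup (GraphDomain A) :=
  NormedAddCommGroup.induced (GraphDomain A) (WithLp 2 (E × F)) (emb A) (emb_injective A)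

instance : NormedSpace ℂ (GraphDomain A) :=
  NormedSpace.induced ℂ (GraphDomain A) (WithLp 2 (E × F)) (emb A)

lemma norm_def (x : GraphDomain A) : ‖x‖ = ‖emb A x‖ := rfl

lemma norm_sq (x : GraphDomain A) :
    ‖x‖ ^ 2 = ‖(A.domain.subtype x : E)‖ ^ 2 + ‖A.toFun x‖ ^ 2 := by
  rw [norm_def, WithLp.prod_norm_sq_eq_of_L2]
  rfl

/-- The inclusion `D(A) → E`. -/
def incl : GraphDomain A →L[ℂ] E :=
  LinearMap.mkContinuous A.domain.subtype 1 (fun x => by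
    rw [one_mul]
    refine abs_le_of_sq_le_sq' ?_ (norm_nonneg x) |>.2
    rw [norm_sq]
    exact le_add_of_nonneg_right (sq_nonneg _))

/-- The operator `A` as a bounded operator `D(A) → F`. -/
def op : GraphDomain A →L[ℂ] F :=
  LinearMap.mkContinuous A.toFun 1 (fun x => by
    rw [one_mul]
    refine abs_le_of_sq_le_sq' ?_ (norm_nonneg x) |>.2
    rw [norm_sq]
    exact le_add_of_nonneg_left (sq_nonneg _))

end GraphDomain

/-- The resolvent set `ρ(A)`: all `s` for which `s - A : D(A) → E` is bijective with bounded
inverse. -/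
def rho (A : E →ₗ.[ℂ] E) : Set ℂ :=
  {s | (s • GraphDomain.incl A - GraphDomain.op A).IsInvertible}

/-- The resolvent `(s - A)⁻¹ : E → D(A)` for `s ∈ ρ(A)` (and `0` for `s ∉ ρ(A)`). -/
def res (A : E →ₗ.[ℂ] E) (s : ℂ) : E →L[ℂ] GraphDomain A :=
  (s • GraphDomain.incl A - GraphDomain.op A).inverse

/-- The space of bounded antilinear functionals on `V`. Pairings `⟨φ, v⟩` are linear in `φ` and
antilinear in `v`, so an inner product linear in its first argument, `⟨x, y⟩`, is `inner ℂ y x`. -/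
abbrev AntiDual (V : Type*) [NormedAddCommGroup V] [NormedSpace ℂ V] := V →L⋆[ℂ] ℂ

/-- The dual map `E → V'` of `j : V → E`, where `E` is identified with its own antidual:
`⟨pivot j x, v⟩ = ⟨x, j v⟩`. -/
def pivot {V : Type*} [NormedAddCommGroup V] [NormedSpace ℂ V] (j : V →L[ℂ] E) :
    E →L[ℂ] AntiDual V :=
  ((innerSL ℂ : E →L⋆[ℂ] E →L[ℂ] ℂ).comp j).flip

lemma pivot_apply {V : Type*} [NormedAddCommGroup V] [NormedSpace ℂ V] (j : V →L[ℂ] E)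
    (x : E) (v : V) : pivot j x v = inner ℂ (j v) x := rfl

variable [CompleteSpace E]

/-- The space `[D(A*)]'`, the dual of `D(A*)` (graph norm) with respect to the pivot space `E`. -/
abbrev Extrap (A : E →ₗ.[ℂ] E) := AntiDual (GraphDomain A.adjoint)

/-- The embedding of the pivot space `E` into `[D(A*)]'`. -/
def toExtrap (A : E →ₗ.[ℂ] E) : E →L[ℂ] Extrap A := pivot (GraphDomain.incl A.adjoint)

/-- The extension `Ã : E → [D(A*)]'` of `A`, with `⟨Ã x, y⟩ = ⟨x, A* y⟩` for `y ∈ D(A*)`. -/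
def extOp (A : E →ₗ.[ℂ] E) : E →L[ℂ] Extrap A := pivot (GraphDomain.op A.adjoint)

/-- `(s - Ã)⁻¹ : [D(A*)]' → E`. -/
def extRes (A : E →ₗ.[ℂ] E) (s : ℂ) : Extrap A →L[ℂ] E := (s • toExtrap A - extOp A).inverse

end Operators

/-! ## Strongly continuous groups, admissibility and the Λ-extension -/

section Groups

/-- A strongly continuous one-parameter group of bounded operators. -/
structure C0Group (E : Type*) [NormedAddCommGroup E] [NormedSpace ℂ E] where
  toFun : ℝ → E →L[ℂ] E
  map_zero : toFun 0 = ContinuousLinearMap.id ℂ E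
  map_add : ∀ s t, toFun (s + t) = (toFun s).comp (toFun t)
  continuous_orbit : ∀ x, Continuous (fun t => toFun t x)

variable {E Y : Type*} [NormedAddCommGroup E] [InnerProductSpace ℂ E]
  [NormedAddCommGroup Y] [InnerProductSpace ℂ Y]

/-- `A` is the (infinitesimal) generator of the group `T`, that is, `T t = e^{At}`. -/
def C0Group.IsGenerator (T : C0Group E) (A : E →ₗ.[ℂ] E) : Prop :=
  ∀ x y : E, (x, y) ∈ A.graph ↔
    Tendsto (fun t : ℝ => (t : ℂ)⁻¹ • (T.toFun t x - x)) (𝓝[>] 0) (𝓝 y)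

lemma C0Group.IsGenerator.mem_domain {T : C0Group E} {A : E →ₗ.[ℂ] E} (hA : T.IsGenerator A)
    (t : ℝ) {x : E} (hx : x ∈ A.domain) : T.toFun t x ∈ A.domain := by
  have h1 := (hA x (A ⟨x, hx⟩)).1 (A.mem_graph ⟨x, hx⟩)
  have h2 := ((T.toFun t).continuous.tendsto _).comp h1
  have h3 := (hA (T.toFun t x) (T.toFun t (A ⟨x, hx⟩))).2 (by
    refine h2.congr (fun s => ?_)
    have e1 : T.toFun t (T.toFun s x) = T.toFun s (T.toFun t x) := by
      have := T.map_add t s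
      rw [add_comm, T.map_add s t] at this
      exact (DFunLike.congr_fun this x).symm
    simp [e1])
  exact LinearPMap.mem_domain_of_mem_graph h3

/-- `e^{At} x` as an element of `D(A)`, for `x ∈ D(A)`. -/
def C0Group.IsGenerator.orbit {T : C0Group E} {A : E →ₗ.[ℂ] E} (hA : T.IsGenerator A)
    (t : ℝ) (x : GraphDomain A) : GraphDomain A :=
  (⟨T.toFun t (GraphDomain.incl A x), hA.mem_domain t (Subtype.property (p := (· ∈ A.domain)) x)⟩ :
    A.domain)

/-- `C ∈ L(D(A), Y)` is an admissible observation operator for `e^{At}`: for some `τ > 0`,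
`∫₀^τ ‖C e^{At} x‖² dt ≤ M ‖x‖²` for all `x ∈ D(A)`. -/
def IsAdmissible {T : C0Group E} {A : E →ₗ.[ℂ] E} (hA : T.IsGenerator A)
    (C : GraphDomain A →L[ℂ] Y) : Prop :=
  ∃ τ : ℝ, 0 < τ ∧ ∃ M : ℝ≥0, ∀ x : GraphDomain A,
    ∫⁻ t in Icc 0 τ, ‖C (hA.orbit t x)‖ₑ ^ 2 ≤ M * ‖GraphDomain.incl A x‖ₑ ^ 2

/-- `y` is the limit of `C s (s - A)⁻¹ x` as `s → +∞` along the reals. -/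
def IsLambdaLimit (A : E →ₗ.[ℂ] E) (C : GraphDomain A →L[ℂ] Y) (x : E) (y : Y) : Prop :=
  Tendsto (fun s : ℝ => C ((s : ℂ) • res A (s : ℂ) x)) atTop (𝓝 y)

/-- The Λ-extension `C_Λ` of `C ∈ L(D(A), Y)` with respect to `A`, defined on those `x` for which
the limit of `C s (s - A)⁻¹ x` as `s → +∞` exists. -/
def lambdaExt (A : E →ₗ.[ℂ] E) (C : GraphDomain A →L[ℂ] Y) : E →ₗ.[ℂ] Y where
  domain :=
    { carrier := {x | ∃ y, IsLambdaLimit A C x y}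
      add_mem' := by
        rintro a b ⟨y, hy⟩ ⟨z, hz⟩
        exact ⟨y + z, (hy.add hz).congr (fun s => by simp)⟩
      zero_mem' := ⟨0, by simp [IsLambdaLimit]⟩
      smul_mem' := by
        rintro c a ⟨y, hy⟩
        exact ⟨c • y, (hy.const_smul c).congr (fun s => by simp only [map_smul]; rw [smul_comm])⟩ }
  toFun :=
    { toFun := fun x => Classical.choose x.2
      map_add' := fun a b => by
        refine tendsto_nhds_unique (Classical.choose_spec (a + b).2)
          (((Classical.choose_spec a.2).add (Classical.choose_spec b.2)).congr (fun s => by simp))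
      map_smul' := fun c a => by
        refine tendsto_nhds_unique (Classical.choose_spec (c • a).2)
          (((Classical.choose_spec a.2).const_smul c).congr
            (fun s => by simp only [SetLike.val_smul, map_smul]; rw [smul_comm])) }

lemma lambdaExt_spec (A : E →ₗ.[ℂ] E) (C : GraphDomain A →L[ℂ] Y) (x : (lambdaExt A C).domain) :
    IsLambdaLimit A C x (lambdaExt A C x) := Classical.choose_spec x.2

end Groups

/-! ## The vanishing right shift on `L²([0,α]; U)` -/

section Shift

variable (α : ℝ) (U : Type*) [NormedAddCommGroup U] [InnerProductSpace ℂ U]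

/-- The Hilbert space `L²([0,α]; U)`. -/
abbrev L2 := Lp U 2 (volume.restrict (Icc (0 : ℝ) α))

variable {α U}

/-- `f ∈ H¹([0,α]; U)` with `f(0) = c` and `f' = g ∈ L²([0,α]; U)`: `f(x) = c + ∫₀ˣ g`. -/
def IsH1 (f g : L2 α U) (c : U) : Prop :=
  ∀ᵐ x ∂(volume.restrict (Icc (0 : ℝ) α)), f x = c + ∫ t in (0 : ℝ)..x, g t

lemma intervalIntegrable_L2 (g : L2 α U) {a b : ℝ} (ha : a ∈ Icc 0 α) (hb : b ∈ Icc 0 α) :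
    IntervalIntegrable g volume a b := by
  have h : Integrable g (volume.restrict (Icc (0 : ℝ) α)) := (Lp.memLp g).integrable (by norm_num)
  refine (IntegrableOn.mono_set (t := Icc (0 : ℝ) α) h ?_).intervalIntegrable
  exact (convex_Icc 0 α).ordConnected.uIcc_subset ha hb

lemma primitive_congr {g g' : ℝ → U} (h : g =ᵐ[volume.restrict (Icc (0 : ℝ) α)] g') {x : ℝ}
    (hx : x ∈ Icc 0 α) : ∫ t in (0 : ℝ)..x, g t = ∫ t in (0 : ℝ)..x, g' t := by
  rw [intervalIntegral.integral_of_le hx.1, intervalIntegral.integral_of_le hx.1]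
  refine integral_congr_ae (ae_restrict_of_ae_restrict_of_subset ?_ h)
  exact fun t ht => ⟨ht.1.le, ht.2.trans hx.2⟩

lemma IsH1.add {f g f' g' : L2 α U} {c c' : U} (h : IsH1 f g c) (h' : IsH1 f' g' c') :
    IsH1 (f + f') (g + g') (c + c') := by
  filter_upwards [h, h', Lp.coeFn_add f f', ae_restrict_mem measurableSet_Icc]
    with x h1 h2 h3 hx
  have h0 : (0 : ℝ) ∈ Icc 0 α := ⟨le_rfl, hx.1.trans hx.2⟩
  rw [h3, Pi.add_apply, h1, h2, primitive_congr (Lp.coeFn_add g g') hx]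
  simp only [Pi.add_apply]
  rw [intervalIntegral.integral_add (intervalIntegrable_L2 g h0 hx)
    (intervalIntegrable_L2 g' h0 hx)]
  abel

lemma IsH1.smul (a : ℂ) {f g : L2 α U} {c : U} (h : IsH1 f g c) :
    IsH1 (a • f) (a • g) (a • c) := by
  filter_upwards [h, Lp.coeFn_smul a f, ae_restrict_mem measurableSet_Icc] with x h1 h3 hx
  rw [h3, Pi.smul_apply, h1, primitive_congr (Lp.coeFn_smul a g) hx]
  simp only [Pi.smul_apply]
  rw [intervalIntegral.integral_smul, smul_add]

lemma isH1_zero : IsH1 (0 : L2 α U) 0 0 := by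
  filter_upwards [Lp.coeFn_zero U 2 (volume.restrict (Icc (0 : ℝ) α)),
    ae_restrict_mem measurableSet_Icc] with x h hx
  rw [h, primitive_congr (Lp.coeFn_zero U 2 (volume.restrict (Icc (0 : ℝ) α))) hx]
  simp

variable [CompleteSpace U]

/-- The derivative and the initial value of an `H¹` function are unique. -/
lemma IsH1.eq_zero [hα : Fact (0 < α)] {g : L2 α U} {c : U} (h : IsH1 0 g c) :
    g = 0 ∧ c = 0 := by
  have h00 : (0 : ℝ) ∈ Icc 0 α := ⟨le_rfl, hα.out.le⟩
  have hαα : α ∈ Icc 0 α := ⟨hα.out.le, le_rfl⟩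
  have hint := intervalIntegrable_L2 g h00 hαα
  have hcont : ContinuousOn (fun x => c + ∫ t in (0 : ℝ)..x, g t) (Icc 0 α) := by
    refine continuousOn_const.add ?_
    have := intervalIntegral.continuousOn_primitive_interval' hint (a := 0) (by simp)
    rwa [uIcc_of_le hα.out.le] at this
  have hae : (fun x => c + ∫ t in (0 : ℝ)..x, g t) =ᵐ[volume.restrict (Icc (0 : ℝ) α)]
      (fun _ => (0 : U)) := by
    filter_upwards [h, Lp.coeFn_zero U 2 (volume.restrict (Icc (0 : ℝ) α))] with x h1 h2
    rw [← h1, h2]; rfl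
  have heq := Measure.eqOn_Icc_of_ae_eq volume hα.out.ne hae hcont continuousOn_const
  have hc : c = 0 := by simpa using heq h00
  refine ⟨?_, hc⟩
  rw [Lp.eq_zero_iff_ae_eq_zero]
  have hd := hint.ae_hasDerivAt_integral
  rw [Filter.EventuallyEq, ae_restrict_iff' measurableSet_Icc]
  have hne0 : ∀ᵐ x : ℝ, x ≠ 0 := by simp [ae_iff, measure_singleton]
  have hneα : ∀ᵐ x : ℝ, x ≠ α := by simp [ae_iff, measure_singleton]
  filter_upwards [hd, hne0, hneα] with x hx h0 h1 hxm
  have hx' := hx (by rwa [uIcc_of_le hα.out.le]) 0 (by simp)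
  have hz : (fun x => ∫ t in (0 : ℝ)..x, g t) =ᶠ[𝓝 x] fun _ => 0 := by
    filter_upwards [Icc_mem_nhds (lt_of_le_of_ne hxm.1 (Ne.symm h0)) (lt_of_le_of_ne hxm.2 h1)]
      with y hy
    simpa [hc] using heq hy
  exact (hx'.congr_of_eventuallyEq hz.symm).unique (hasDerivAt_const x 0)

lemma IsH1.unique [Fact (0 < α)] {f g g' : L2 α U} {c c' : U} (h : IsH1 f g c)
    (h' : IsH1 f g' c') : g = g' ∧ c = c' := by
  have h2 := h.add (h'.smul (-1))
  have e : f + (-1 : ℂ) • f = 0 := by simp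
  rw [e] at h2
  obtain ⟨h3, h4⟩ := h2.eq_zero
  constructor
  · simpa [← sub_eq_add_neg, sub_eq_zero] using h3
  · simpa [← sub_eq_add_neg, sub_eq_zero] using h4

variable (α U)

/-- The derivative `f ↦ f'` on `L²([0,α]; U)` with domain `H¹([0,α]; U)`. -/
def deriv1 [Fact (0 < α)] : L2 α U →ₗ.[ℂ] L2 α U where
  domain :=
    { carrier := {f | ∃ g c, IsH1 f g c}
      add_mem' := by
        rintro f f' ⟨g, c, h⟩ ⟨g', c', h'⟩
        exact ⟨_, _, h.add h'⟩
      zero_mem' := ⟨0, 0, isH1_zero⟩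
      smul_mem' := by
        rintro a f ⟨g, c, h⟩
        exact ⟨_, _, h.smul a⟩ }
  toFun :=
    { toFun := fun f => Classical.choose f.2
      map_add' := fun f f' => by
        obtain ⟨c, h⟩ := Classical.choose_spec f.2
        obtain ⟨c', h'⟩ := Classical.choose_spec f'.2
        obtain ⟨c'', h''⟩ := Classical.choose_spec (f + f').2
        exact (h''.unique (h.add h')).1
      map_smul' := fun a f => by
        obtain ⟨c, h⟩ := Classical.choose_spec f.2
        obtain ⟨c'', h''⟩ := Classical.choose_spec (a • f).2
        exact (h''.unique (h.smul a)).1 }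

/-- The space `H¹([0,α]; U)`, with norm `(‖f‖² + ‖f'‖²)^(1/2)`. -/
abbrev H1 [Fact (0 < α)] := GraphDomain (deriv1 α U)

variable {α U}

lemma H1.exists_isH1 [Fact (0 < α)] (f : H1 α U) :
    ∃ c, IsH1 (GraphDomain.incl _ f) (GraphDomain.op _ f) c :=
  Classical.choose_spec (Subtype.property (p := (· ∈ (deriv1 α U).domain)) f)

/-- The value at `0` of (the continuous representative of) an `H¹` function. -/
def H1.initVal [Fact (0 < α)] (f : H1 α U) : U := Classical.choose f.exists_isH1

lemma H1.isH1 [Fact (0 < α)] (f : H1 α U) :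
    IsH1 (GraphDomain.incl _ f) (GraphDomain.op _ f) f.initVal :=
  Classical.choose_spec f.exists_isH1

/-- A bound of the integral by the `L²` norm. -/
lemma norm_integral_le (g : L2 α U) {x : ℝ} (hx : x ∈ Icc 0 α) :
    ‖∫ t in (0 : ℝ)..x, g t‖ ≤ (∫ t in Icc 0 α, ‖g t‖) := by
  have h : Integrable g (volume.restrict (Icc (0 : ℝ) α)) := (Lp.memLp g).integrable (by norm_num)
  rw [intervalIntegral.integral_of_le hx.1]
  refine (norm_integral_le_integral_norm _).trans ?_
  refine setIntegral_mono_set h.norm (Eventually.of_forall fun _ => norm_nonneg _) ?_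
  exact LE.le.eventuallyLE fun t ht => ⟨ht.1.le, ht.2.trans hx.2⟩

lemma integral_norm_le [hα : Fact (0 < α)] (g : L2 α U) :
    (∫ t in Icc 0 α, ‖g t‖) ≤ √α * ‖g‖ := by
  have h := eLpNorm_le_eLpNorm_mul_rpow_measure_univ (p := 1) (q := 2)
    (μ := volume.restrict (Icc (0 : ℝ) α)) (f := g) (by norm_num) (Lp.aestronglyMeasurable g)
  have hi : Integrable g (volume.restrict (Icc (0 : ℝ) α)) := (Lp.memLp g).integrable (by norm_num)
  have e1 : (∫ t in Icc 0 α, ‖g t‖) = (eLpNorm g 1 (volume.restrict (Icc (0 : ℝ) α))).toReal := by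
    rw [eLpNorm_one_eq_lintegral_enorm, integral_norm_eq_lintegral_enorm hi.aestronglyMeasurable]
  rw [e1, Lp.norm_def, mul_comm]
  have h2 : (eLpNorm g 2 (volume.restrict (Icc (0 : ℝ) α))) ≠ ⊤ := (Lp.memLp g).eLpNorm_ne_top
  have h3 := ENNReal.toReal_mono (ENNReal.mul_ne_top h2 (ENNReal.rpow_ne_top_of_nonneg (by norm_num) (measure_ne_top _ _))) h
  rw [ENNReal.toReal_mul] at h3
  refine h3.trans (le_of_eq ?_)
  congr 1
  rw [Measure.restrict_apply_univ, Real.volume_Icc, ← ENNReal.toReal_rpow, sub_zero,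
    ENNReal.toReal_ofReal hα.out.le, Real.sqrt_eq_rpow]
  norm_num

lemma H1.norm_initVal_le [hα : Fact (0 < α)] (f : H1 α U) :
    ‖f.initVal‖ ≤ (α⁻¹ * √α + √α) * ‖f‖ := by
  set I := ∫ t in Icc 0 α, ‖(GraphDomain.op _ f : L2 α U) t‖ with hI
  have hi : Integrable (GraphDomain.incl _ f : L2 α U) (volume.restrict (Icc (0 : ℝ) α)) :=
    (Lp.memLp _).integrable (by norm_num)
  have h1 : ∀ᵐ x ∂(volume.restrict (Icc (0 : ℝ) α)),
      ‖f.initVal‖ ≤ ‖(GraphDomain.incl _ f : L2 α U) x‖ + I := by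
    filter_upwards [f.isH1, ae_restrict_mem measurableSet_Icc] with x h hx
    have : f.initVal = (GraphDomain.incl _ f : L2 α U) x -
        ∫ t in (0 : ℝ)..x, (GraphDomain.op _ f : L2 α U) t := by rw [h]; abel
    rw [this]
    exact (norm_sub_le _ _).trans (by gcongr; exact norm_integral_le _ hx)
  have h2 := integral_mono_ae (integrable_const _) (hi.norm.add (integrable_const I)) h1
  have h3 : ∫ x in Icc 0 α, (‖(GraphDomain.incl _ f : L2 α U) x‖ + I) =
      (∫ x in Icc 0 α, ‖(GraphDomain.incl _ f : L2 α U) x‖) + α * I := by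
    rw [integral_add hi.norm (integrable_const I)]
    simp [hα.out.le]
  have h4 : α * ‖f.initVal‖ ≤ (∫ x in Icc 0 α, ‖(GraphDomain.incl _ f : L2 α U) x‖) + α * I := by
    rw [← h3]
    simpa [hα.out.le] using h2
  have h5 := integral_norm_le (GraphDomain.incl _ f : L2 α U)
  have h6 := integral_norm_le (GraphDomain.op _ f : L2 α U)
  have h7 := (GraphDomain.incl (deriv1 α U)).le_of_opNorm_le
    (LinearMap.mkContinuous_norm_le _ zero_le_one _) f
  have h8 := (GraphDomain.op (deriv1 α U)).le_of_opNorm_le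
    (LinearMap.mkContinuous_norm_le _ zero_le_one _) f
  rw [one_mul] at h7 h8
  have h9 : α * ‖f.initVal‖ ≤ √α * ‖f‖ + α * (√α * ‖f‖) := by
    refine h4.trans (add_le_add (h5.trans ?_) ?_)
    · gcongr
    · have := hα.out
      gcongr
      exact h6.trans (by gcongr)
  have hα' := hα.out
  have : ‖f.initVal‖ ≤ α⁻¹ * (√α * ‖f‖ + α * (√α * ‖f‖)) := by
    rw [le_inv_mul_iff₀ hα']; exact h9
  refine this.trans (le_of_eq ?_)
  field_simp

variable (α U)

/-- The trace `f ↦ f(0)` on `H¹([0,α]; U)`. -/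
def trace0 [Fact (0 < α)] : H1 α U →L[ℂ] U :=
  LinearMap.mkContinuous
    { toFun := fun f => f.initVal
      map_add' := fun f f' => by
        have h := f.isH1.add f'.isH1
        rw [← map_add, ← map_add] at h
        exact ((f + f').isH1.unique h).2
      map_smul' := fun a f => by
        have h := f.isH1.smul a
        rw [← map_smul, ← map_smul] at h
        exact ((a • f).isH1.unique h).2 }
    (α⁻¹ * √α + √α) (fun f => f.norm_initVal_le)

/-- The integral `∫₀^α g` as a bounded functional of `g ∈ L²([0,α]; U)`. -/
def totalIntegral [Fact (0 < α)] : L2 α U →L[ℂ] U :=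
  LinearMap.mkContinuous
    { toFun := fun g => ∫ t in (0 : ℝ)..α, g t
      map_add' := fun g g' => by
        have hα : 0 ≤ α := (Fact.out : 0 < α).le
        rw [primitive_congr (Lp.coeFn_add g g') ⟨hα, le_rfl⟩]
        exact intervalIntegral.integral_add (intervalIntegrable_L2 g ⟨le_rfl, hα⟩ ⟨hα, le_rfl⟩)
          (intervalIntegrable_L2 g' ⟨le_rfl, hα⟩ ⟨hα, le_rfl⟩)
      map_smul' := fun a g => by
        have hα : 0 ≤ α := (Fact.out : 0 < α).le
        rw [primitive_congr (Lp.coeFn_smul a g) ⟨hα, le_rfl⟩]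
        exact intervalIntegral.integral_smul a _ }
    √α (fun g => (norm_integral_le g ⟨(Fact.out : 0 < α).le, le_rfl⟩).trans (integral_norm_le g))

/-- The operator `C_α : H¹([0,α]; U) → U`, `f ↦ f(α) = f(0) + ∫₀^α f'`. -/
def traceEnd [Fact (0 < α)] : H1 α U →L[ℂ] U :=
  trace0 α U + (totalIntegral α U).comp (GraphDomain.op (deriv1 α U))

/-- The generator `G_α f = -f'` of the vanishing right shift semigroup, with domain
`{f ∈ H¹([0,α]; U) | f(0) = 0}`. -/
def shiftGen [Fact (0 < α)] : L2 α U →ₗ.[ℂ] L2 α U :=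
  (-deriv1 α U).domRestrict
    ((LinearMap.ker (trace0 α U).toLinearMap).map (GraphDomain.incl (deriv1 α U)).toLinearMap)

variable {α U}

/-- Every `c + ∫₀ˣ g` with `g ∈ L²` is (the representative of) an `H¹` function. -/
lemma exists_isH1 [hα : Fact (0 < α)] (g : L2 α U) (c : U) : ∃ f : L2 α U, IsH1 f g c := by
  have h00 : (0 : ℝ) ∈ Icc 0 α := ⟨le_rfl, hα.out.le⟩
  have hαα : α ∈ Icc 0 α := ⟨hα.out.le, le_rfl⟩
  have hint := intervalIntegrable_L2 g h00 hαα
  have hcont : ContinuousOn (fun x => c + ∫ t in (0 : ℝ)..x, g t) (Icc 0 α) := by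
    refine continuousOn_const.add ?_
    have := intervalIntegral.continuousOn_primitive_interval' hint (a := 0) (by simp)
    rwa [uIcc_of_le hα.out.le] at this
  have hm : MemLp (fun x => c + ∫ t in (0 : ℝ)..x, g t) 2 (volume.restrict (Icc (0 : ℝ) α)) := by
    obtain ⟨K, hK⟩ := isCompact_Icc.exists_bound_of_continuousOn hcont
    refine MemLp.of_bound
      (hcont.aestronglyMeasurable_of_isCompact isCompact_Icc measurableSet_Icc) K ?_
    filter_upwards [ae_restrict_mem measurableSet_Icc] with x hx using hK x hx
  exact ⟨hm.toLp _, hm.coeFn_toLp⟩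

lemma IsH1.mem_shiftGen [Fact (0 < α)] {f g : L2 α U} (h : IsH1 f g 0) :
    ∃ hf : f ∈ (shiftGen α U).domain, shiftGen α U ⟨f, hf⟩ = -g := by
  have hd : f ∈ (deriv1 α U).domain := ⟨g, 0, h⟩
  let F : H1 α U := (⟨f, hd⟩ : (deriv1 α U).domain)
  have h1 := F.isH1.unique (show IsH1 (GraphDomain.incl _ F) g 0 from h)
  refine ⟨⟨⟨F, h1.2, rfl⟩, hd⟩, ?_⟩
  exact congrArg Neg.neg h1.1

/-- Integration by parts, for `W(x) = -∫ₓ^α k` and `f(x) = ∫₀ˣ g`. -/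
lemma inner_primitive [hα : Fact (0 < α)] {W k f g : L2 α U}
    (hW : IsH1 W k (-∫ t in (0 : ℝ)..α, k t)) (hf : IsH1 f g 0) :
    inner ℂ W g = - inner ℂ k f := by
  have hα' := hα.out
  set ν := volume.restrict (Icc (0 : ℝ) α) with hν
  have hk : Integrable k ν := (Lp.memLp k).integrable (by norm_num)
  have hg : Integrable g ν := (Lp.memLp g).integrable (by norm_num)
  have h0 : (0 : ℝ) ∈ Icc 0 α := ⟨le_rfl, hα'.le⟩
  have hαα : α ∈ Icc 0 α := ⟨hα'.le, le_rfl⟩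
  have hWx : ∀ᵐ x ∂ν, W x = - ∫ t, (Ioi x).indicator k t ∂ν := by
    filter_upwards [hW, ae_restrict_mem measurableSet_Icc] with x h hx
    rw [h, integral_indicator measurableSet_Ioi, hν, Measure.restrict_restrict measurableSet_Ioi,
      ← intervalIntegral.integral_add_adjacent_intervals (intervalIntegrable_L2 k h0 hx)
        (intervalIntegrable_L2 k hx hαα), intervalIntegral.integral_of_le hx.2]
    have : Ioi x ∩ Icc 0 α = Ioc x α := by
      ext t; constructor
      · rintro ⟨h1, h2⟩; exact ⟨h1, h2.2⟩
      · rintro ⟨h1, h2⟩; exact ⟨h1, hx.1.trans h1.le, h2⟩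
    rw [this]; abel
  have hfx : ∀ᵐ t ∂ν, f t = ∫ x, (Iio t).indicator g x ∂ν := by
    filter_upwards [hf, ae_restrict_mem measurableSet_Icc] with x h hx
    rw [h, integral_indicator measurableSet_Iio, hν, Measure.restrict_restrict measurableSet_Iio,
      intervalIntegral.integral_of_le hx.1, zero_add, ← integral_Icc_eq_integral_Ioc,
      integral_Icc_eq_integral_Ico]
    congr 2
    ext t; constructor
    · rintro ⟨h1, h2⟩; exact ⟨h2, h1, h2.le.trans hx.2⟩
    · rintro ⟨h1, h2⟩; exact ⟨h2.1, h1⟩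
  let Φ : ℝ → ℝ → ℂ := fun t x => (Iio t).indicator (fun x => inner ℂ (k t) (g x)) x
  have hΦ' : ∀ t x, Φ t x = (Ioi x).indicator (fun t => inner ℂ (k t) (g x)) t := by
    intro t x
    by_cases h : x < t <;> simp [Φ, h, indicator]
  have hΦint : Integrable (Function.uncurry Φ) (ν.prod ν) := by
    have hb : Integrable (fun z : ℝ × ℝ => ‖k z.1‖ * ‖g z.2‖) (ν.prod ν) :=
      hk.norm.mul_prod hg.norm
    have hm : AEStronglyMeasurable (fun z : ℝ × ℝ => inner ℂ (k z.1) (g z.2)) (ν.prod ν) :=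
      (hk.aestronglyMeasurable.comp_fst).inner (hg.aestronglyMeasurable.comp_snd)
    have hi : Integrable (fun z : ℝ × ℝ => inner ℂ (k z.1) (g z.2)) (ν.prod ν) :=
      hb.mono' hm (Eventually.of_forall fun z => norm_inner_le_norm _ _)
    have hs : MeasurableSet {z : ℝ × ℝ | z.2 < z.1} := measurableSet_lt measurable_snd measurable_fst
    exact (hi.indicator hs).congr (Eventually.of_forall fun z => by
      simp [Function.uncurry, Φ, indicator])
  have hswap := integral_integral_swap hΦint
  have hL : ∀ᵐ t ∂ν, ∫ x, Φ t x ∂ν = inner ℂ (k t) (f t) := by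
    filter_upwards [hfx] with t ht
    rw [ht, ← integral_inner (hg.indicator measurableSet_Iio)]
    refine integral_congr_ae (Eventually.of_forall fun x => ?_)
    by_cases h : x < t <;> simp [Φ, h, indicator]
  have hR : ∀ᵐ x ∂ν, ∫ t, Φ t x ∂ν = - inner ℂ (W x) (g x) := by
    filter_upwards [hWx] with x hx
    rw [hx, inner_neg_left, neg_neg, ← inner_conj_symm,
      ← integral_inner (hk.indicator measurableSet_Ioi), ← integral_conj]
    refine integral_congr_ae (Eventually.of_forall fun t => ?_)
    by_cases h : x < t <;> simp [hΦ', h, indicator]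
  rw [integral_congr_ae hL, integral_congr_ae hR, integral_neg] at hswap
  rw [L2.inner_def, L2.inner_def, hswap, neg_neg]

lemma dense_shiftGen [Fact (0 < α)] : Dense ((shiftGen α U).domain : Set (L2 α U)) := by
  rw [Submodule.dense_iff_topologicalClosure_eq_top, Submodule.topologicalClosure_eq_top_iff,
    Submodule.eq_bot_iff]
  intro y hy
  obtain ⟨W, hW⟩ := exists_isH1 y (-∫ t in (0 : ℝ)..α, y t)
  have hW0 : W = 0 := by
    refine ext_inner_right ℂ (fun g => ?_)
    obtain ⟨f, hf⟩ := exists_isH1 g 0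
    obtain ⟨hf1, -⟩ := hf.mem_shiftGen
    rw [inner_primitive hW hf, inner_zero_left, ← inner_conj_symm, hy f hf1]
    simp
  rw [hW0] at hW
  exact hW.eq_zero.1

/-- A function `h ∈ D(G_α*)` lies in `H¹([0,α]; U)`, with `h' = G_α* h` and `h(α) = 0`. -/
lemma adjoint_isH1 [Fact (0 < α)] (h : (shiftGen α U).adjoint.domain) :
    IsH1 (h : L2 α U) ((shiftGen α U).adjoint h)
      (-∫ t in (0 : ℝ)..α, ((shiftGen α U).adjoint h) t) := by
  set k := (shiftGen α U).adjoint h with hk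
  obtain ⟨W, hW⟩ := exists_isH1 k (-∫ t in (0 : ℝ)..α, k t)
  suffices e : (h : L2 α U) = W by rw [e]; exact hW
  refine ext_inner_right ℂ (fun g => ?_)
  obtain ⟨f, hf⟩ := exists_isH1 g 0
  obtain ⟨hf1, hf2⟩ := hf.mem_shiftGen
  have h1 := (shiftGen α U).adjoint_isFormalAdjoint dense_shiftGen h ⟨f, hf1⟩
  rw [hf2, inner_neg_right] at h1
  rw [inner_primitive hW hf, ← neg_eq_iff_eq_neg]
  exact h1.symm

variable (α U)

/-- The inclusion `D(G_α*) → H¹([0,α]; U)`. -/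
def adjointToH1 [Fact (0 < α)] : GraphDomain (shiftGen α U).adjoint →L[ℂ] H1 α U :=
  LinearMap.mkContinuous
    { toFun := fun h => (⟨GraphDomain.incl _ h, ⟨_, _, adjoint_isH1 h⟩⟩ : (deriv1 α U).domain)
      map_add' := fun h h' => Subtype.ext (map_add (GraphDomain.incl _) h h')
      map_smul' := fun a h => Subtype.ext (map_smul (GraphDomain.incl _) a h) }
    1 (fun h => by
      let F : H1 α U :=
        (⟨GraphDomain.incl _ h, ⟨_, _, adjoint_isH1 h⟩⟩ : (deriv1 α U).domain)
      have h1 := (F.isH1.unique (show IsH1 (GraphDomain.incl _ F) _ _ from adjoint_isH1 h)).1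
      rw [one_mul]
      change ‖F‖ ≤ ‖h‖
      refine abs_le_of_sq_le_sq' (le_of_eq ?_) (norm_nonneg h) |>.2
      rw [GraphDomain.norm_sq, GraphDomain.norm_sq]
      congr 2
      exact congrArg norm h1)

/-- The operator `B_α : U → [H¹([0,α]; U)]'`, `⟨B_α u, f⟩ = ⟨u, f(0)⟩`. -/
def deltaH1 [Fact (0 < α)] : U →L[ℂ] AntiDual (H1 α U) := pivot (trace0 α U)

/-- `B_α` as an operator into `[D(G_α*)]'`: the functionals `deltaH1 α U u` are restricted to
`D(G_α*) ⊂ H¹([0,α]; U)`, so that `⟨B_α u, f⟩ = ⟨u, f(0)⟩` for `f ∈ D(G_α*)`. -/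
def deltaB [Fact (0 < α)] : U →L[ℂ] Extrap (shiftGen α U) :=
  pivot ((trace0 α U).comp (adjointToH1 α U))

lemma deltaB_apply [Fact (0 < α)] (u : U) (f : GraphDomain (shiftGen α U).adjoint) :
    deltaB α U u f = deltaH1 α U u (adjointToH1 α U f) := rfl

/-- The inclusion `D(G_α) → H¹([0,α]; U)`. -/
def genToH1 [Fact (0 < α)] : GraphDomain (shiftGen α U) →L[ℂ] H1 α U :=
  LinearMap.mkContinuous
    { toFun := fun h => (⟨GraphDomain.incl _ h, (Subtype.property
        (p := (· ∈ (shiftGen α U).domain)) h).2⟩ : (deriv1 α U).domain)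
      map_add' := fun h h' => Subtype.ext (map_add (GraphDomain.incl _) h h')
      map_smul' := fun a h => Subtype.ext (map_smul (GraphDomain.incl _) a h) }
    1 (fun h => by
      let F : H1 α U := (⟨GraphDomain.incl _ h, (Subtype.property
        (p := (· ∈ (shiftGen α U).domain)) h).2⟩ : (deriv1 α U).domain)
      rw [one_mul]
      change ‖F‖ ≤ ‖h‖
      refine abs_le_of_sq_le_sq' (le_of_eq ?_) (norm_nonneg h) |>.2
      rw [GraphDomain.norm_sq, GraphDomain.norm_sq]
      congr 2
      exact (norm_neg _).symm)

/-- `C_α ∈ L(D(G_α), U)`: the restriction of `f ↦ f(α)` to `D(G_α)`. -/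
def traceC [Fact (0 < α)] : GraphDomain (shiftGen α U) →L[ℂ] U :=
  (traceEnd α U).comp (genToH1 α U)

end Shift

/-! ## The observability map and its extension -/

section Observation

variable {Z Y : Type*} [NormedAddCommGroup Z] [InnerProductSpace ℂ Z] [CompleteSpace Z]
  [NormedAddCommGroup Y] [InnerProductSpace ℂ Y] [CompleteSpace Y]

/-- `Ψ` is the observability map of `(-A, -C)` on `[0,μ]`: for every `z`, one has
`e^{-Ax} z ∈ D(C_Λ)` and `(Ψ z)(x) = -C_Λ e^{-Ax} z` for almost every `x ∈ [0,μ]`. -/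
def IsObservabilityMap (T : C0Group Z) (A : Z →ₗ.[ℂ] Z) (C : GraphDomain A →L[ℂ] Y) (μ : ℝ)
    (Ψ : Z →L[ℂ] L2 μ Y) : Prop :=
  ∀ z : Z, ∀ᵐ x ∂(volume.restrict (Icc (0 : ℝ) μ)),
    ∃ h : T.toFun (-x) z ∈ (lambdaExt A C).domain, Ψ z x = -lambdaExt A C ⟨T.toFun (-x) z, h⟩

/-- The space `Z_F = {z ∈ Z | Ã z + F y ∈ Z for some y ∈ Y}`. -/
def zSpace (A : Z →ₗ.[ℂ] Z) (F : Y →L[ℂ] Extrap A) : Submodule ℂ Z where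
  carrier := {z | ∃ y : Y, ∃ w : Z, extOp A z + F y = toExtrap A w}
  add_mem' := by
    rintro z z' ⟨y, w, h⟩ ⟨y', w', h'⟩
    exact ⟨y + y', w + w', by rw [map_add, map_add, map_add, ← h, ← h']; abel⟩
  zero_mem' := ⟨0, 0, by simp⟩
  smul_mem' := by
    rintro c z ⟨y, w, h⟩
    exact ⟨c • y, c • w, by rw [map_smul, map_smul, map_smul, ← h, smul_add]⟩

/-- The subspace `Z + F Y` of `[D(A*)]'`. -/
def sumSpace (A : Z →ₗ.[ℂ] Z) (F : Y →L[ℂ] Extrap A) : Submodule ℂ (Extrap A) :=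
  LinearMap.range (toExtrap A).toLinearMap ⊔ LinearMap.range F.toLinearMap

/-- The operator `[B_μ C_Λ + (s - G̃_μ) Ψ] (s - Ã)⁻¹`, defined for those `φ ∈ [D(A*)]'` with
`(s - Ã)⁻¹ φ ∈ D(C_Λ)`, with values in `[D(G_μ*)]'`. -/
def extFormula (A : Z →ₗ.[ℂ] Z) (C : GraphDomain A →L[ℂ] Y) (μ : ℝ) [Fact (0 < μ)]
    (Ψ : Z →L[ℂ] L2 μ Y) (s : ℂ) : Extrap A →ₗ.[ℂ] Extrap (shiftGen μ Y) where
  domain := (lambdaExt A C).domain.comap (extRes A s).toLinearMap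
  toFun :=
    (deltaB μ Y).toLinearMap ∘ₗ (lambdaExt A C).toFun ∘ₗ
        ((extRes A s).toLinearMap.restrict (fun _ h => h)) +
      (s • toExtrap (shiftGen μ Y) - extOp (shiftGen μ Y)).toLinearMap ∘ₗ Ψ.toLinearMap ∘ₗ
        (extRes A s).toLinearMap ∘ₗ Submodule.subtype _

lemma extFormula_apply (A : Z →ₗ.[ℂ] Z) (C : GraphDomain A →L[ℂ] Y) (μ : ℝ) [Fact (0 < μ)]
    (Ψ : Z →L[ℂ] L2 μ Y) (s : ℂ) (φ : (extFormula A C μ Ψ s).domain) :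
    extFormula A C μ Ψ s φ = deltaB μ Y (lambdaExt A C ⟨extRes A s φ, φ.2⟩) +
      (s • toExtrap (shiftGen μ Y) (Ψ (extRes A s φ)) - extOp (shiftGen μ Y) (Ψ (extRes A s φ))) :=
  rfl

/-- `P` is the operator `[B_μ C_Λ + (s - G̃_μ) Ψ] (s - Ã)⁻¹` with domain (exactly) `Z + F Y`;
in particular that formula makes sense on all of `Z + F Y`. -/
def IsExtensionFor (A : Z →ₗ.[ℂ] Z) (C : GraphDomain A →L[ℂ] Y) (F : Y →L[ℂ] Extrap A) (μ : ℝ)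
    [Fact (0 < μ)] (Ψ : Z →L[ℂ] L2 μ Y) (s : ℂ)
    (P : Extrap A →ₗ.[ℂ] Extrap (shiftGen μ Y)) : Prop :=
  P.domain = sumSpace A F ∧ P ≤ extFormula A C μ Ψ s

end Observation

end

end DelaySylvester

/-! Everything algebraic rests on one identity on D(A). For d ∈ D(A) the function Ψ d is in H¹, with
initial value -C d and derivative -Ψ A d (`isH1_obs`). Integration by parts against D(G_μ*), whose
elements vanish at μ, gives G̃_μ f = -f' - B_μ f(0) for f ∈ H¹ (`IsH1.extOp_shiftGen`). Together:
B_μ C d + (s - G̃_μ) Ψ d = Ψ (s - A) d (`deltaB_add_obs`).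

Hence the bracket B_μ C_Λ + (s - G̃_μ) Ψ changes by Ψ (s - A) d when its argument is shifted by d
(`sylvester_value_add`). Independence of s follows, since two extrapolated resolvents differ by an
element of D(A); so does P = Ψ on Z, since there the resolvent takes values in D(A); so does the
Sylvester equation, from (s - Ã)⁻¹ Ã z = (s - A)⁻¹ s z - z. The inclusion Z_F ⊂ D(C_Λ) makes C_Λ
applicable to all arguments that occur.

The analytic work is the construction of Ψ. Admissibility and the group property bound it on D(A),
and density extends it. Its primitive is C applied to an orbit integral (`integral_obs`), so
Lebesgue differentiation gives, at almost every x, a limit of C applied to averages of the orbit. An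
Abelian theorem turns such limits into limits of C s (s - A)⁻¹
(`C0Group.IsGenerator.isLambdaLimit_of_tendsto`).

For (iii), the Λ-extension of the end trace must evaluate every H¹ function at μ, also those not
vanishing at 0 (`IsH1.isLambdaLimit`). A constant is treated with the explicit resolvent, the rest
with the dissipativity of the shift. -/

namespace DelaySylvester

noncomputable section

/-! ### Graph-norm domains -/

section GraphDomainBasics

variable {E F : Type*} [NormedAddCommGroup E] [InnerProductSpace ℂ E]
  [NormedAddCommGroup F] [InnerProductSpace ℂ F] {A : E →ₗ.[ℂ] F}

namespace GraphDomain

/-- The element of `D(A)` given by a point `(x, y)` of the graph of `A`. -/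
def ofGraph (x : E) (y : F) (h : (x, y) ∈ A.graph) : GraphDomain A :=
  (⟨x, LinearPMap.mem_domain_of_mem_graph h⟩ : A.domain)

@[simp] lemma incl_ofGraph (x : E) (y : F) (h : (x, y) ∈ A.graph) :
    incl A (ofGraph x y h) = x := rfl

@[simp] lemma op_ofGraph (x : E) (y : F) (h : (x, y) ∈ A.graph) :
    op A (ofGraph x y h) = y := by
  exact ((LinearPMap.image_iff (LinearPMap.mem_domain_of_mem_graph h)).2 h).symm

lemma mem_graph (x : GraphDomain A) : (incl A x, op A x) ∈ A.graph :=
  LinearPMap.mem_graph A (x : A.domain)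

lemma incl_mem (x : GraphDomain A) : incl A x ∈ A.domain :=
  Subtype.property (p := (· ∈ A.domain)) x

lemma incl_injective : Function.Injective (incl A) := fun _ _ h => Subtype.ext h

lemma op_eq_of_mem_graph {x : GraphDomain A} {y : F} (h : (incl A x, y) ∈ A.graph) :
    op A x = y := by
  have : x = ofGraph _ y h := incl_injective rfl
  rw [this, op_ofGraph]

lemma norm_le (x : GraphDomain A) : ‖x‖ ≤ ‖incl A x‖ + ‖op A x‖ := by
  refine abs_le_of_sq_le_sq' ?_ (by positivity) |>.2
  rw [norm_sq]
  change ‖incl A x‖ ^ 2 + ‖op A x‖ ^ 2 ≤ _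
  nlinarith [mul_nonneg (norm_nonneg (incl A x)) (norm_nonneg (op A x))]

lemma tendsto_iff {ι : Type*} {l : Filter ι} {f : ι → GraphDomain A} {x : GraphDomain A} :
    Tendsto f l (𝓝 x) ↔ Tendsto (fun i => incl A (f i)) l (𝓝 (incl A x)) ∧
      Tendsto (fun i => op A (f i)) l (𝓝 (op A x)) := by
  constructor
  · exact fun h => ⟨((incl A).continuous.tendsto _).comp h, ((op A).continuous.tendsto _).comp h⟩
  · rintro ⟨h1, h2⟩
    rw [tendsto_iff_norm_sub_tendsto_zero] at h1 h2 ⊢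
    refine squeeze_zero (fun _ => norm_nonneg _) (fun i => norm_le _) ?_
    simpa using h1.add h2

lemma continuous_iff {X : Type*} [TopologicalSpace X] {f : X → GraphDomain A} :
    Continuous f ↔ Continuous (fun i => incl A (f i)) ∧ Continuous (fun i => op A (f i)) := by
  simp only [continuous_iff_continuousAt, ContinuousAt, tendsto_iff, forall_and]

/-- A pair of bounded operators whose values lie in the graph of `A`, as a bounded operator into
`D(A)`. -/
def lift {V : Type*} [NormedAddCommGroup V] [NormedSpace ℂ V] (f : V →L[ℂ] E) (g : V →L[ℂ] F)
    (h : ∀ v, (f v, g v) ∈ A.graph) : V →L[ℂ] GraphDomain A :=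
  LinearMap.mkContinuous
    { toFun := fun v => ofGraph (f v) (g v) (h v)
      map_add' := fun v w => incl_injective (by simp)
      map_smul' := fun c v => incl_injective (by simp) }
    (‖f‖ + ‖g‖) (fun v => by
      refine (norm_le _).trans ?_
      rw [add_mul]
      simpa using add_le_add (f.le_opNorm v) (g.le_opNorm v))

@[simp] lemma op_lift {V : Type*} [NormedAddCommGroup V] [NormedSpace ℂ V] (f : V →L[ℂ] E)
    (g : V →L[ℂ] F) (h : ∀ v, (f v, g v) ∈ A.graph) (v : V) : op A (lift f g h v) = g v :=
  op_ofGraph _ _ (h v)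

lemma norm_lift_le {V : Type*} [NormedAddCommGroup V] [NormedSpace ℂ V] (f : V →L[ℂ] E)
    (g : V →L[ℂ] F) (h : ∀ v, (f v, g v) ∈ A.graph) : ‖lift f g h‖ ≤ ‖f‖ + ‖g‖ :=
  LinearMap.mkContinuous_norm_le _ (by positivity) _

end GraphDomain

end GraphDomainBasics

/-! ### Resolvents -/

section ResolventBasics

variable {E : Type*} [NormedAddCommGroup E] [InnerProductSpace ℂ E] {A : E →ₗ.[ℂ] E} {s : ℂ}

lemma sub_op_res (hs : s ∈ rho A) (x : E) :
    s • GraphDomain.incl A (res A s x) - GraphDomain.op A (res A s x) = x := by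
  have h : (s • GraphDomain.incl A - GraphDomain.op A).IsInvertible := hs
  exact (h.inverse_apply_eq.1 (rfl : res A s x = res A s x)).symm

lemma res_eq (hs : s ∈ rho A) {x : E} {d : GraphDomain A}
    (h : s • GraphDomain.incl A d - GraphDomain.op A d = x) : res A s x = d := by
  have h' : (s • GraphDomain.incl A - GraphDomain.op A).IsInvertible := hs
  exact h'.inverse_apply_eq.2 h.symm

lemma res_sub_op (hs : s ∈ rho A) (d : GraphDomain A) :
    res A s (s • GraphDomain.incl A d - GraphDomain.op A d) = d := res_eq hs rfl

/-- The map s - A is a linear homeomorphism onto E. Completeness lets bounded operators pass through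
D(A)-valued integrals. -/
lemma completeSpace_graphDomain [CompleteSpace E] (hs : s ∈ rho A) :
    CompleteSpace (GraphDomain A) := by
  obtain ⟨e, -⟩ := hs
  exact (completeSpace_congr (e := e.toEquiv) e.isUniformEmbedding).2 inferInstance

end ResolventBasics

/-! ### Orbit integrals of a strongly continuous group -/

namespace C0Group

variable {E : Type*} [NormedAddCommGroup E] [NormedSpace ℂ E] (T : C0Group E)

lemma apply_add (s t : ℝ) (x : E) : T.toFun (s + t) x = T.toFun s (T.toFun t x) := by
  rw [T.map_add]; rfl

lemma apply_zero (x : E) : T.toFun 0 x = x := by rw [T.map_zero]; rfl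

lemma apply_comm (s t : ℝ) (x : E) : T.toFun s (T.toFun t x) = T.toFun t (T.toFun s x) := by
  rw [← apply_add, add_comm, apply_add]

lemma exists_bound [CompleteSpace E] (a b : ℝ) :
    ∃ M : ℝ, 0 < M ∧ ∀ t ∈ Icc a b, ‖T.toFun t‖ ≤ M := by
  obtain ⟨M, hM⟩ := banach_steinhaus (g := fun t : Icc a b => T.toFun t) (fun x => by
    obtain ⟨K, hK⟩ := isCompact_Icc.exists_bound_of_continuousOn
      (T.continuous_orbit x).continuousOn (s := Icc a b)
    exact ⟨K, fun t => hK t t.2⟩)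
  exact ⟨max M 1, by positivity, fun t ht => (hM ⟨t, ht⟩).trans (le_max_left _ _)⟩

/-- The group `e^{-st} T(t)`. -/
def rescale (s : ℝ) : C0Group E where
  toFun t := (Real.exp (-(s * t)) : ℂ) • T.toFun t
  map_zero := by simp [T.map_zero]
  map_add t u := by
    ext x
    simp only [mul_add, neg_add, Real.exp_add, T.map_add]
    simp [smul_smul, mul_comm]
  continuous_orbit x := by
    have := T.continuous_orbit x
    change Continuous fun t => (Real.exp (-(s * t)) : ℂ) • T.toFun t x
    fun_prop

lemma rescale_apply (s t : ℝ) (x : E) :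
    (T.rescale s).toFun t x = (Real.exp (-(s * t)) : ℂ) • T.toFun t x := rfl

variable [CompleteSpace E]

lemma intervalIntegrable (x : E) (a b : ℝ) :
    IntervalIntegrable (fun t => T.toFun t x) volume a b :=
  (T.continuous_orbit x).intervalIntegrable a b

/-- The operator `x ↦ ∫₀ᵗ T(σ) x dσ`. -/
def avg (t : ℝ) : E →L[ℂ] E :=
  LinearMap.mkContinuousOfExistsBound
    { toFun := fun x => ∫ σ in (0 : ℝ)..t, T.toFun σ x
      map_add' := fun x y => by
        simp only [_root_.map_add]
        exact intervalIntegral.integral_add (T.intervalIntegrable x _ _) (T.intervalIntegrable y _ _)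
      map_smul' := fun c x => by
        simp only [map_smul, RingHom.id_apply]
        exact intervalIntegral.integral_smul _ _ }
    (by
      obtain ⟨M, -, hM⟩ := T.exists_bound (min 0 t) (max 0 t)
      refine ⟨M * |t - 0|, fun x => ?_⟩
      have := intervalIntegral.norm_integral_le_of_norm_le_const (a := 0) (b := t)
        (f := fun σ => T.toFun σ x) (C := M * ‖x‖) (fun σ hσ => by
          refine ((T.toFun σ).le_opNorm x).trans ?_
          gcongr
          exact hM σ (uIoc_subset_uIcc hσ))
      exact this.trans (le_of_eq (by ring)))

lemma avg_apply (t : ℝ) (x : E) : T.avg t x = ∫ σ in (0 : ℝ)..t, T.toFun σ x := rfl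

lemma norm_avg_le {t M : ℝ} (hM : ∀ σ ∈ uIoc 0 t, ‖T.toFun σ‖ ≤ M) (hM0 : 0 ≤ M) :
    ‖T.avg t‖ ≤ M * |t| := by
  refine ContinuousLinearMap.opNorm_le_bound _ (by positivity) (fun x => ?_)
  rw [avg_apply]
  have := intervalIntegral.norm_integral_le_of_norm_le_const (a := 0) (b := t)
    (f := fun σ => T.toFun σ x) (C := M * ‖x‖) (fun σ hσ => by
      refine ((T.toFun σ).le_opNorm x).trans ?_
      gcongr
      exact hM σ hσ)
  exact this.trans (le_of_eq (by rw [sub_zero]; ring))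

lemma hasDerivAt_avg (t : ℝ) (x : E) : HasDerivAt (fun t => T.avg t x) (T.toFun t x) t :=
  intervalIntegral.integral_hasDerivAt_right (T.intervalIntegrable x _ _)
    ((T.continuous_orbit x).stronglyMeasurableAtFilter _ _) (T.continuous_orbit x).continuousAt

lemma continuous_avg (x : E) : Continuous (fun t => T.avg t x) :=
  continuous_iff_continuousAt.2 fun t => (T.hasDerivAt_avg t x).continuousAt

@[simp] lemma avg_zero (x : E) : T.avg 0 x = 0 := by simp [avg_apply]

lemma avg_apply_orbit (t r : ℝ) (x : E) : T.avg t (T.toFun r x) = T.avg (t + r) x - T.avg r x := by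
  simp only [avg_apply, ← apply_add]
  rw [intervalIntegral.integral_comp_add_right (fun σ => T.toFun σ x), zero_add,
    intervalIntegral.integral_interval_sub_left (T.intervalIntegrable x _ _)
      (T.intervalIntegrable x _ _)]

lemma orbit_avg (t r : ℝ) (x : E) : T.toFun r (T.avg t x) = T.avg (t + r) x - T.avg r x := by
  rw [← avg_apply_orbit, avg_apply, avg_apply,
    ← ContinuousLinearMap.intervalIntegral_comp_comm _ (T.intervalIntegrable x _ _)]
  simp only [T.apply_comm]

lemma tendsto_inv_smul_of_hasDerivAt {F : Type*} [NormedAddCommGroup F] [NormedSpace ℂ F]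
    {f : ℝ → F} {y : F} {x : ℝ}
    (h : HasDerivAt f y x) :
    Tendsto (fun t : ℝ => (t : ℂ)⁻¹ • (f (t + x) - f x)) (𝓝[>] 0) (𝓝 y) := by
  have := h.tendsto_slope_zero_right
  refine this.congr fun t => ?_
  rw [← Complex.ofReal_inv, Complex.coe_smul, add_comm]

lemma tendsto_diffQuot_avg (t : ℝ) (x : E) :
    Tendsto (fun h : ℝ => (h : ℂ)⁻¹ • (T.toFun h (T.avg t x) - T.avg t x)) (𝓝[>] 0)
      (𝓝 (T.toFun t x - x)) := by
  have h1 := tendsto_inv_smul_of_hasDerivAt (T.hasDerivAt_avg t x)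
  have h2 := tendsto_inv_smul_of_hasDerivAt (T.hasDerivAt_avg 0 x)
  rw [T.apply_zero] at h2
  refine (h1.sub h2).congr fun h => ?_
  rw [← smul_sub, orbit_avg, avg_zero, add_zero, add_comm h t]
  congr 1
  abel

end C0Group

/-! ### Orbit integrals and the generator -/

section Generator

variable {E : Type*} [NormedAddCommGroup E] [InnerProductSpace ℂ E] [CompleteSpace E]
  {T : C0Group E} {A : E →ₗ.[ℂ] E}

namespace C0Group.IsGenerator

lemma incl_orbit (hA : T.IsGenerator A) (t : ℝ) (x : GraphDomain A) :
    GraphDomain.incl A (hA.orbit t x) = T.toFun t (GraphDomain.incl A x) := rfl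

lemma op_orbit (hA : T.IsGenerator A) (t : ℝ) (x : GraphDomain A) :
    GraphDomain.op A (hA.orbit t x) = T.toFun t (GraphDomain.op A x) := by
  refine GraphDomain.op_eq_of_mem_graph ((hA _ _).2 ?_)
  have h1 := (hA _ _).1 x.mem_graph
  refine (((T.toFun t).continuous.tendsto _).comp h1).congr fun s => ?_
  rw [incl_orbit, T.apply_comm s t]
  simp

lemma continuous_orbit' (hA : T.IsGenerator A) (x : GraphDomain A) :
    Continuous (fun t => hA.orbit t x) := by
  refine GraphDomain.continuous_iff.2 ⟨T.continuous_orbit _, ?_⟩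
  simp only [op_orbit]
  exact T.continuous_orbit _

/-- The difference quotient of the rescaled group at w is known. Writing T(h) = e^{sh} · e^{-sh}
T(h) adds the term h⁻¹(e^{sh} - 1) w, which tends to s w. -/
lemma avg_rescale_mem_graph (hA : T.IsGenerator A) (s t : ℝ) (x : E) :
    ((T.rescale s).avg t x, (s : ℂ) • (T.rescale s).avg t x + ((T.rescale s).toFun t x - x)) ∈
      A.graph := by
  refine (hA _ _).2 ?_
  set w := (T.rescale s).avg t x
  have h1 := (T.rescale s).tendsto_diffQuot_avg t x
  have h2 : Tendsto (fun h : ℝ => (Real.exp (s * h) : ℂ)) (𝓝[>] 0) (𝓝 1) := by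
    have : Continuous fun h : ℝ => (Real.exp (s * h) : ℂ) := by fun_prop
    have := this.tendsto 0
    simp only [mul_zero, Real.exp_zero, Complex.ofReal_one] at this
    exact this.mono_left nhdsWithin_le_nhds
  have h3 : Tendsto (fun h : ℝ => (h : ℂ)⁻¹ * ((Real.exp (s * h) : ℂ) - 1)) (𝓝[>] 0) (𝓝 s) := by
    have hd : HasDerivAt (fun h : ℝ => Real.exp (s * h)) s 0 := by
      have := ((hasDerivAt_id (0 : ℝ)).const_mul s).exp
      simpa using this
    have := tendsto_inv_smul_of_hasDerivAt hd.ofReal_comp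
    simpa using this
  have h4 := (h2.smul h1).add (h3.smul_const w)
  rw [one_smul, add_comm] at h4
  refine h4.congr fun h => ?_
  rw [T.rescale_apply, smul_sub, smul_sub, smul_sub, smul_smul, smul_smul, smul_smul, mul_sub,
    sub_smul]
  have : (Real.exp (s * h) : ℂ) * (h : ℂ)⁻¹ * (Real.exp (-(s * h)) : ℂ) = (h : ℂ)⁻¹ := by
    rw [mul_comm (Real.exp (s * h) : ℂ), mul_assoc, ← Complex.ofReal_mul, ← Real.exp_add]; simp
  rw [this, mul_one, mul_comm (h : ℂ)⁻¹]
  abel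

lemma rescale_zero_eq : T.rescale 0 = T := by
  cases T; simp [C0Group.rescale]

lemma avg_mem_graph (hA : T.IsGenerator A) (t : ℝ) (x : E) :
    (T.avg t x, T.toFun t x - x) ∈ A.graph := by
  have := hA.avg_rescale_mem_graph 0 t x
  simpa [rescale_zero_eq] using this

/-- The operator `x ↦ ∫₀ᵗ T(σ) x dσ` as a bounded operator into `D(A)`. -/
def avgDom (hA : T.IsGenerator A) (t : ℝ) : E →L[ℂ] GraphDomain A :=
  GraphDomain.lift (T.avg t) (T.toFun t - ContinuousLinearMap.id ℂ E) (hA.avg_mem_graph t)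

@[simp] lemma incl_avgDom (hA : T.IsGenerator A) (t : ℝ) (x : E) :
    GraphDomain.incl A (hA.avgDom t x) = T.avg t x := rfl

@[simp] lemma op_avgDom (hA : T.IsGenerator A) (t : ℝ) (x : E) :
    GraphDomain.op A (hA.avgDom t x) = T.toFun t x - x :=
  GraphDomain.op_lift _ _ _ x

lemma continuous_avgDom (hA : T.IsGenerator A) (x : E) : Continuous fun t => hA.avgDom t x := by
  refine GraphDomain.continuous_iff.2 ⟨T.continuous_avg x, ?_⟩
  simp only [op_avgDom]
  exact (T.continuous_orbit x).sub continuous_const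

lemma avgDom_orbit (hA : T.IsGenerator A) (t r : ℝ) (x : E) :
    hA.avgDom t (T.toFun r x) = hA.avgDom (t + r) x - hA.avgDom r x :=
  GraphDomain.incl_injective (by simp [C0Group.avg_apply_orbit])

/-- The averages t⁻¹ ∫₀ᵗ T(σ) x dσ lie in D(A) and tend to x. -/
lemma denseRange_incl (hA : T.IsGenerator A) : DenseRange (GraphDomain.incl A) := by
  intro x
  have h := tendsto_inv_smul_of_hasDerivAt (T.hasDerivAt_avg 0 x)
  rw [T.apply_zero] at h
  refine mem_closure_of_tendsto h (Eventually.of_forall fun t => ?_)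
  refine ⟨(t : ℂ)⁻¹ • hA.avgDom t x, ?_⟩
  simp

lemma dense_domain (hA : T.IsGenerator A) : Dense (A.domain : Set E) := by
  refine hA.denseRange_incl.mono ?_
  rintro _ ⟨d, rfl⟩
  exact d.incl_mem

/-- The definition of the generator yields right derivatives only; with continuity of the orbit they
suffice for the fundamental theorem of calculus. -/
lemma hasDerivWithinAt_orbit (hA : T.IsGenerator A) (x : GraphDomain A) (t : ℝ) :
    HasDerivWithinAt (fun t => T.toFun t (GraphDomain.incl A x))
      (T.toFun t (GraphDomain.op A x)) (Ioi t) t := by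
  have h := (hA _ _).1 (hA.orbit t x).mem_graph
  rw [op_orbit, incl_orbit] at h
  rw [hasDerivWithinAt_iff_tendsto_slope' (by simp)]
  have hmap : Tendsto (fun u : ℝ => u - t) (𝓝[>] t) (𝓝[>] 0) := by
    refine tendsto_nhdsWithin_iff.2 ⟨?_, ?_⟩
    · have : Continuous fun u : ℝ => u - t := by fun_prop
      have := this.tendsto t
      rw [sub_self] at this
      exact this.mono_left nhdsWithin_le_nhds
    · filter_upwards [self_mem_nhdsWithin] with u hu using sub_pos.2 (mem_Ioi.1 hu)
  refine (h.comp hmap).congr fun u => ?_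
  simp only [Function.comp, slope, vsub_eq_sub]
  rw [← C0Group.apply_add, sub_add_cancel, ← Complex.ofReal_inv, Complex.coe_smul]

lemma avg_op (hA : T.IsGenerator A) (t : ℝ) (x : GraphDomain A) :
    T.avg t (GraphDomain.op A x) = T.toFun t (GraphDomain.incl A x) - GraphDomain.incl A x := by
  have := intervalIntegral.integral_eq_sub_of_hasDeriv_right (a := 0) (b := t)
    (T.continuous_orbit (GraphDomain.incl A x)).continuousOn
    (fun u _ => hA.hasDerivWithinAt_orbit x u) (T.intervalIntegrable _ _ _)
  rw [T.apply_zero] at this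
  exact this

lemma avgDom_op (hA : T.IsGenerator A) (t : ℝ) (x : GraphDomain A) :
    hA.avgDom t (GraphDomain.op A x) = hA.orbit t x - x :=
  GraphDomain.incl_injective (by simp [hA.avg_op, incl_orbit])

/-- The operator `Q = ∫₀¹ e^{-st} T(t) dt` as a bounded operator into `D(A)`. -/
def laplaceDom (hA : T.IsGenerator A) (s : ℝ) : E →L[ℂ] GraphDomain A :=
  GraphDomain.lift ((T.rescale s).avg 1) ((s : ℂ) • (T.rescale s).avg 1 +
    ((T.rescale s).toFun 1 - ContinuousLinearMap.id ℂ E)) (hA.avg_rescale_mem_graph s 1)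

@[simp] lemma incl_laplaceDom (hA : T.IsGenerator A) (s : ℝ) (x : E) :
    GraphDomain.incl A (hA.laplaceDom s x) = (T.rescale s).avg 1 x := rfl

@[simp] lemma op_laplaceDom (hA : T.IsGenerator A) (s : ℝ) (x : E) :
    GraphDomain.op A (hA.laplaceDom s x) =
      (s : ℂ) • (T.rescale s).avg 1 x + ((T.rescale s).toFun 1 x - x) :=
  GraphDomain.op_lift _ _ _ x

/-- Stopping the Laplace integral at time 1 avoids growth bounds for the group: the error is e^{-s}
T(1), which is small for large s. -/
lemma sub_op_laplaceDom (hA : T.IsGenerator A) (s : ℝ) (x : E) :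
    (s : ℂ) • GraphDomain.incl A (hA.laplaceDom s x) - GraphDomain.op A (hA.laplaceDom s x) =
      x - (T.rescale s).toFun 1 x := by
  rw [incl_laplaceDom, op_laplaceDom]; abel

end C0Group.IsGenerator
end Generator

/-! ### An Abelian theorem for Laplace averages -/

section LaplaceAverages

lemma tendsto_pow_mul_exp_neg_mul (n : ℕ) {δ : ℝ} (hδ : 0 < δ) :
    Tendsto (fun s : ℝ => s ^ n * Real.exp (-(s * δ))) atTop (𝓝 0) := by
  have h1 := (Real.tendsto_pow_mul_exp_neg_atTop_nhds_zero n).comp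
    (tendsto_id.atTop_mul_const hδ)
  have h2 := h1.const_mul ((δ ^ n)⁻¹)
  rw [mul_zero] at h2
  refine h2.congr fun s => ?_
  simp only [Function.comp, id]
  rw [mul_pow, ← mul_assoc, mul_comm (s ^ n), ← mul_assoc, inv_mul_cancel₀ (pow_ne_zero _ hδ.ne'),
    one_mul]

lemma integral_laplace_kernel (s : ℝ) :
    ∫ t in (0 : ℝ)..1, s ^ 2 * t * Real.exp (-(s * t)) = 1 - (1 + s) * Real.exp (-s) := by
  have hd : ∀ t : ℝ, HasDerivAt (fun t => -((1 + s * t) * Real.exp (-(s * t))))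
      (s ^ 2 * t * Real.exp (-(s * t))) t := by
    intro t
    have h1 : HasDerivAt (fun t : ℝ => s * t) s t := by
      simpa using (hasDerivAt_id t).const_mul s
    have := ((h1.const_add 1).mul h1.neg.exp).neg
    refine this.congr_deriv ?_
    simp only [Pi.neg_apply]
    ring
  rw [intervalIntegral.integral_eq_sub_of_hasDerivAt (fun t _ => hd t)
    (Continuous.intervalIntegrable (by fun_prop) _ _)]
  simp
  ring

variable {F : Type*} [NormedAddCommGroup F] [NormedSpace ℝ F]

/-- Assigning the value y at 0 makes the integrand continuous on the compact interval [0,1]. -/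
lemma integrableOn_inv_smul {J : ℝ → F} (hJ : Continuous J) {y : F}
    (h : Tendsto (fun t => t⁻¹ • J t) (𝓝[>] 0) (𝓝 y)) :
    IntegrableOn (fun t => t⁻¹ • J t) (Ioc 0 1) := by
  have h1 : ContinuousOn (Function.update (fun t => t⁻¹ • J t) 0 y) (Icc 0 1) := by
    rw [continuousOn_update_iff]
    refine ⟨fun t ht => ?_, fun _ => ?_⟩
    · refine ContinuousAt.continuousWithinAt ?_
      exact (continuousAt_inv₀ ht.2).smul hJ.continuousAt
    · refine h.mono_left (nhdsWithin_mono _ ?_)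
      rintro t ⟨ht1, ht2⟩
      exact lt_of_le_of_ne ht1.1 (Ne.symm ht2)
  refine (h1.integrableOn_Icc.mono_set Ioc_subset_Icc_self).congr_fun (fun t ht => ?_)
    measurableSet_Ioc
  exact Function.update_of_ne ht.1.ne' _ _

/-- An Abelian theorem: if `J(t) / t → y` as `t → 0+`, then `∫₀¹ s² e^{-st} J(t) dt → y` as
`s → +∞`. -/
lemma tendsto_laplace [CompleteSpace F] {J : ℝ → F} (hJ : Continuous J) {y : F}
    (h : Tendsto (fun t => t⁻¹ • J t) (𝓝[>] 0) (𝓝 y)) :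
    Tendsto (fun s : ℝ => ∫ t in (0 : ℝ)..1, (s ^ 2 * Real.exp (-(s * t))) • J t) atTop (𝓝 y) := by
  -- The kernels s² t e^{-st} are nonnegative, have mass tending to 1 on (0,1], and concentrate at
  -- 0; they act on J(t)/t.
  have key := tendsto_setIntegral_peak_smul_of_integrableOn_of_tendsto (μ := volume)
    (s := Ioc (0 : ℝ) 1) (t := Ioc (0 : ℝ) 1) (x₀ := 0) (l := atTop)
    (φ := fun (s : ℝ) (t : ℝ) => s ^ 2 * t * Real.exp (-(s * t))) (g := fun t => t⁻¹ • J t) (a := y)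
    measurableSet_Ioc measurableSet_Ioc Subset.rfl self_mem_nhdsWithin (by simp)
    (Eventually.of_forall fun s t ht => by
      have := ht.1.le
      positivity)
    (fun u hu h0 => by
      obtain ⟨δ, hδ, hball⟩ := Metric.isOpen_iff.1 hu 0 h0
      rw [Metric.tendstoUniformlyOn_iff]
      intro ε hε
      filter_upwards [(tendsto_order.1 (tendsto_pow_mul_exp_neg_mul 2 hδ)).2 ε hε,
        eventually_ge_atTop 0] with s hs hs0 t ht
      have ht0 := ht.1.1
      have hδt : δ ≤ t := by
        by_contra! hlt
        exact ht.2 (hball (by rw [Metric.mem_ball, Real.dist_eq, sub_zero, abs_of_pos ht0]; exact hlt))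
      rw [Pi.zero_apply, dist_zero_left, Real.norm_of_nonneg (by positivity)]
      refine lt_of_le_of_lt ?_ hs
      calc s ^ 2 * t * Real.exp (-(s * t)) ≤ s ^ 2 * 1 * Real.exp (-(s * δ)) := by
            gcongr
            exact ht.1.2
        _ = _ := by ring)
    (by
      simp only [← intervalIntegral.integral_of_le (zero_le_one' ℝ), integral_laplace_kernel]
      have h0 := tendsto_pow_mul_exp_neg_mul 0 one_pos
      have h1 := tendsto_pow_mul_exp_neg_mul 1 one_pos
      have := ((h0.add h1).const_sub 1)
      simp only [pow_zero, pow_one, mul_one, add_zero, sub_zero, ← add_mul] at this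
      exact this)
    (Eventually.of_forall fun s => Continuous.aestronglyMeasurable (by fun_prop))
    (integrableOn_inv_smul hJ h)
    (h.mono_left (nhdsWithin_mono _ Ioc_subset_Ioi_self))
  refine key.congr fun s => ?_
  rw [intervalIntegral.integral_of_le zero_le_one]
  refine setIntegral_congr_fun measurableSet_Ioc fun t ht => ?_
  have := ht.1.ne'
  simp only [smul_smul]
  congr 1
  field_simp

end LaplaceAverages

/-! ### Resolvent of the generator and Λ-limits -/

section LambdaLimits

variable {E : Type*} [NormedAddCommGroup E] [InnerProductSpace ℂ E] [CompleteSpace E]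
  {T : C0Group E} {A : E →ₗ.[ℂ] E}

lemma C0Group.norm_rescale_le (T : C0Group E) (s t : ℝ) :
    ‖(T.rescale s).toFun t‖ ≤ Real.exp (-(s * t)) * ‖T.toFun t‖ := by
  refine (norm_smul_le _ _).trans (le_of_eq ?_)
  rw [Complex.norm_real, Real.norm_of_nonneg (Real.exp_pos _).le]

namespace C0Group.IsGenerator

/-- A Neumann series inverts 1 - e^{-s} T(1) = (s - A) Q, with Q the truncated Laplace integral, and
so gives a right inverse of s - A. It is two-sided because s - A is injective. -/
lemma mem_rho (hA : T.IsGenerator A) {s : ℝ} (hs : ‖(T.rescale s).toFun 1‖ < 1) :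
    (s : ℂ) ∈ rho A := by
  obtain ⟨n, hn⟩ := isUnit_one_sub_of_norm_lt_one hs
  have hL : ∀ x, (s : ℂ) • GraphDomain.incl A (hA.laplaceDom s x) -
      GraphDomain.op A (hA.laplaceDom s x) = (n : E →L[ℂ] E) x := by
    intro x
    rw [hA.sub_op_laplaceDom, hn]
    rfl
  have hinj : ∀ d : GraphDomain A, (s : ℂ) • GraphDomain.incl A d - GraphDomain.op A d = 0 →
      d = 0 := by
    intro d hd
    -- If A d = s d, then e^{-st} T(t) d has right derivative 0 and is constant; so d is fixed by
    -- e^{-s} T(1) and is killed by the invertible 1 - e^{-s} T(1).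
    have hfix : (T.rescale s).toFun 1 (GraphDomain.incl A d) = GraphDomain.incl A d := by
      have hcont : Continuous fun t : ℝ => (T.rescale s).toFun t (GraphDomain.incl A d) :=
        (T.rescale s).continuous_orbit _
      have hder : ∀ t, HasDerivWithinAt (fun t : ℝ => (T.rescale s).toFun t (GraphDomain.incl A d))
          0 (Ioi t) t := by
        intro t
        have h1 : HasDerivAt (fun t : ℝ => (Real.exp (-(s * t)) : ℂ))
            (Real.exp (-(s * t)) * (-s) : ℝ) t := by
          have h0 : HasDerivAt (fun t : ℝ => s * t) s t := by
            simpa using (hasDerivAt_id t).const_mul s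
          exact h0.neg.exp.ofReal_comp
        have h2 := h1.hasDerivWithinAt.smul (hA.hasDerivWithinAt_orbit d t)
        refine h2.congr_deriv ?_
        rw [← sub_eq_zero.1 hd, map_smul, smul_smul, ← add_smul]
        push_cast
        ring_nf
        simp
      have := intervalIntegral.integral_eq_sub_of_hasDeriv_right (a := 0) (b := 1)
        hcont.continuousOn (fun t _ => hder t) (by simp)
      rw [intervalIntegral.integral_zero, (T.rescale s).apply_zero, eq_comm, sub_eq_zero] at this
      exact this
    have h0 : (n : E →L[ℂ] E) (GraphDomain.incl A d) = 0 := by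
      rw [hn]
      exact sub_eq_zero.2 hfix.symm
    refine GraphDomain.incl_injective ?_
    have h2 := congrArg (fun x => (↑n⁻¹ : E →L[ℂ] E) x) h0
    have h3 : (↑n⁻¹ : E →L[ℂ] E) ((n : E →L[ℂ] E) (GraphDomain.incl A d)) = GraphDomain.incl A d :=
      DFunLike.congr_fun n.inv_mul (GraphDomain.incl A d)
    simpa [h3] using h2
  have hright : ∀ x, (s : ℂ) • GraphDomain.incl A (hA.laplaceDom s ((↑n⁻¹ : E →L[ℂ] E) x)) -
      GraphDomain.op A (hA.laplaceDom s ((↑n⁻¹ : E →L[ℂ] E) x)) = x := by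
    intro x
    rw [hL]
    exact DFunLike.congr_fun n.mul_inv x
  refine ContinuousLinearMap.IsInvertible.of_inverse (g := (hA.laplaceDom s).comp (↑n⁻¹ : E →L[ℂ] E))
    ?_ ?_
  · ext x
    exact hright x
  · ext d
    rw [← sub_eq_zero]
    refine hinj _ ?_
    rw [map_sub, map_sub, smul_sub]
    have := hright ((s : ℂ) • GraphDomain.incl A d - GraphDomain.op A d)
    rw [sub_sub_sub_comm]
    exact sub_eq_zero.2 this

/-- From (s - A)⁻¹ = Q + (s - A)⁻¹ e^{-s} T(1), the last term has at most half the norm of the left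
side and is absorbed. -/
lemma norm_res_le (hA : T.IsGenerator A) {s : ℝ} (hs : ‖(T.rescale s).toFun 1‖ ≤ 1 / 2) :
    ‖res A (s : ℂ)‖ ≤ 2 * ‖hA.laplaceDom s‖ := by
  have hs' : (s : ℂ) ∈ rho A := hA.mem_rho (hs.trans_lt (by norm_num))
  have h : res A (s : ℂ) = hA.laplaceDom s + (res A (s : ℂ)).comp ((T.rescale s).toFun 1) := by
    ext x
    have h1 := res_eq hs' (hA.sub_op_laplaceDom s x)
    change _ = hA.laplaceDom s x + res A (s : ℂ) ((T.rescale s).toFun 1 x)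
    rw [← h1, map_sub]
    abel
  have h2 : ‖res A (s : ℂ)‖ ≤ ‖hA.laplaceDom s‖ + ‖res A (s : ℂ)‖ * (1 / 2) := by
    nth_rw 1 [h]
    refine (norm_add_le _ _).trans ?_
    gcongr
    exact ((res A (s : ℂ)).opNorm_comp_le _).trans (by gcongr)
  linarith

lemma eventually_norm_rescale_le (T : C0Group E) :
    ∀ᶠ s : ℝ in atTop, ‖(T.rescale s).toFun 1‖ ≤ 1 / 2 := by
  have h := (tendsto_pow_mul_exp_neg_mul 0 one_pos).mul_const ‖T.toFun 1‖
  simp only [pow_zero, one_mul, zero_mul] at h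
  filter_upwards [(tendsto_order.1 h).2 (1 / 2) (by norm_num)] with s hs
  exact (T.norm_rescale_le s 1).trans hs.le

lemma eventually_mem_rho (hA : T.IsGenerator A) : ∀ᶠ s : ℝ in atTop, (s : ℂ) ∈ rho A := by
  filter_upwards [eventually_norm_rescale_le T] with s hs
  exact hA.mem_rho (hs.trans_lt (by norm_num))

lemma rho_nonempty (hA : T.IsGenerator A) : (rho A).Nonempty :=
  let ⟨s, hs⟩ := hA.eventually_mem_rho.exists
  ⟨s, hs⟩

/-- Crude linear growth in s is enough, because the bound will be multiplied by e^{-s}. -/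
lemma exists_norm_laplaceDom_le (hA : T.IsGenerator A) :
    ∃ M : ℝ, 0 < M ∧ ∀ s : ℝ, 0 ≤ s → ‖hA.laplaceDom s‖ ≤ M + s * M + (M + 1) := by
  obtain ⟨M, hM, hb⟩ := T.exists_bound 0 1
  refine ⟨M, hM, fun s hs => ?_⟩
  have hb' : ∀ t ∈ Icc (0 : ℝ) 1, ‖(T.rescale s).toFun t‖ ≤ M := by
    intro t ht
    refine (T.norm_rescale_le s t).trans ?_
    have : Real.exp (-(s * t)) ≤ 1 := Real.exp_le_one_iff.2 (by nlinarith [ht.1])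
    nlinarith [hb t ht, norm_nonneg (T.toFun t)]
  have havg : ‖(T.rescale s).avg 1‖ ≤ M := by
    have := (T.rescale s).norm_avg_le (t := 1) (M := M) (fun σ hσ => hb' σ (by
      rw [uIoc_of_le zero_le_one] at hσ
      exact Ioc_subset_Icc_self hσ)) hM.le
    simpa using this
  refine (GraphDomain.norm_lift_le _ _ _).trans ?_
  have h1 : ‖(s : ℂ) • (T.rescale s).avg 1‖ ≤ s * M := by
    refine (norm_smul_le _ _).trans ?_
    rw [Complex.norm_real, Real.norm_of_nonneg hs]
    gcongr
  have h2 : ‖(T.rescale s).toFun 1 - ContinuousLinearMap.id ℂ E‖ ≤ M + 1 :=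
    (norm_sub_le _ _).trans (add_le_add (hb' 1 (by simp)) ContinuousLinearMap.norm_id_le)
  exact add_le_add havg ((norm_add_le _ _).trans (add_le_add h1 h2)) |>.trans (by linarith)

/-- Integration by parts replaces T(t) x, which need not lie in D(A), by its primitive, which does;
C can then be applied under the integral. -/
lemma laplaceDom_eq (hA : T.IsGenerator A) (s : ℝ) (x : E) :
    hA.laplaceDom s x = Real.exp (-s) • hA.avgDom 1 x +
      ∫ t in (0 : ℝ)..1, (s * Real.exp (-(s * t))) • hA.avgDom t x := by
  obtain ⟨r, hr⟩ := hA.rho_nonempty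
  have := completeSpace_graphDomain hr
  refine GraphDomain.incl_injective ?_
  have hint : IntervalIntegrable (fun t => (s * Real.exp (-(s * t))) • hA.avgDom t x) volume 0 1 := by
    have := hA.continuous_avgDom x
    exact Continuous.intervalIntegrable (by fun_prop) _ _
  have hcomm := ((GraphDomain.incl A).intervalIntegral_comp_comm hint)
  rw [_root_.map_add, ← hcomm, incl_laplaceDom, ← Complex.coe_smul, map_smul, incl_avgDom,
    Complex.coe_smul]
  have hstep : ∀ t, GraphDomain.incl A ((s * Real.exp (-(s * t))) • hA.avgDom t x) =
      (s * Real.exp (-(s * t))) • T.avg t x := by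
    intro t
    rw [← Complex.coe_smul, map_smul, incl_avgDom, Complex.coe_smul]
  simp only [hstep]
  have hd : ∀ t : ℝ, HasDerivAt (fun t => Real.exp (-(s * t)) • T.avg t x)
      (Real.exp (-(s * t)) • T.toFun t x - (s * Real.exp (-(s * t))) • T.avg t x) t := by
    intro t
    have h0 : HasDerivAt (fun t : ℝ => s * t) s t := by
      simpa using (hasDerivAt_id t).const_mul s
    refine (h0.neg.exp.smul (T.hasDerivAt_avg t x)).congr_deriv ?_
    rw [sub_eq_add_neg, ← neg_smul]
    congr 2
    simp only [Pi.neg_apply]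
    ring
  have hc1 : Continuous fun t => Real.exp (-(s * t)) • T.toFun t x := by
    have := T.continuous_orbit x
    fun_prop
  have hc2 : Continuous fun t => (s * Real.exp (-(s * t))) • T.avg t x := by
    have := T.continuous_avg x
    fun_prop
  have hI := intervalIntegral.integral_eq_sub_of_hasDerivAt (a := 0) (b := 1) (fun t _ => hd t)
    ((hc1.sub hc2).intervalIntegrable _ _)
  rw [intervalIntegral.integral_sub (hc1.intervalIntegrable _ _) (hc2.intervalIntegrable _ _),
    C0Group.avg_zero, smul_zero, sub_zero, mul_one, sub_eq_iff_eq_add] at hI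
  rw [← hI, C0Group.avg_apply]
  refine intervalIntegral.integral_congr fun t _ => ?_
  simp only [T.rescale_apply, Complex.coe_smul]

variable {Y : Type*} [NormedAddCommGroup Y] [InnerProductSpace ℂ Y] [CompleteSpace Y]

/-- The Lebesgue extension is contained in the Λ-extension. -/
lemma isLambdaLimit_of_tendsto (hA : T.IsGenerator A) (C : GraphDomain A →L[ℂ] Y) {x : E} {y : Y}
    (h : Tendsto (fun t : ℝ => (t : ℂ)⁻¹ • C (hA.avgDom t x)) (𝓝[>] 0) (𝓝 y)) :
    IsLambdaLimit A C x y := by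
  obtain ⟨r, hr⟩ := hA.rho_nonempty
  have := completeSpace_graphDomain hr
  have hJ : Continuous fun t => C (hA.avgDom t x) := C.continuous.comp (hA.continuous_avgDom x)
  have h1 := tendsto_laplace hJ (h.congr fun t => by rw [← Complex.ofReal_inv, Complex.coe_smul])
  have h2 := (tendsto_pow_mul_exp_neg_mul 1 one_pos).smul_const (C (hA.avgDom 1 x))
  rw [zero_smul] at h2
  -- The truncation error: s times the resolvent, as a map into D(A), grows at most quadratically,
  -- against the factor e^{-s}.
  have h3 : Tendsto (fun s : ℝ => C ((s : ℂ) • res A (s : ℂ) ((T.rescale s).toFun 1 x))) atTop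
      (𝓝 0) := by
    obtain ⟨M, hM, hb⟩ := hA.exists_norm_laplaceDom_le
    set K := ‖C‖ * (2 * ‖T.toFun 1‖ * ‖x‖)
    have hlim : Tendsto (fun s : ℝ => K * ((2 * M + 1) * (s ^ 1 * Real.exp (-(s * 1))) +
        M * (s ^ 2 * Real.exp (-(s * 1))))) atTop (𝓝 0) := by
      have := (((tendsto_pow_mul_exp_neg_mul 1 one_pos).const_mul (2 * M + 1)).add
        ((tendsto_pow_mul_exp_neg_mul 2 one_pos).const_mul M)).const_mul K
      simpa only [mul_zero, add_zero] using this
    refine squeeze_zero_norm' ?_ hlim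
    filter_upwards [eventually_norm_rescale_le T, eventually_ge_atTop 0] with s hs hs0
    have e1 := (hA.norm_res_le hs).trans (mul_le_mul_of_nonneg_left (hb s hs0) zero_le_two)
    have e2 : ‖(T.rescale s).toFun 1 x‖ ≤ Real.exp (-(s * 1)) * ‖T.toFun 1‖ * ‖x‖ :=
      ((T.rescale s).toFun 1).le_of_opNorm_le (T.norm_rescale_le s 1) x
    calc ‖C ((s : ℂ) • res A (s : ℂ) ((T.rescale s).toFun 1 x))‖
        ≤ ‖C‖ * (s * (2 * (M + s * M + (M + 1)) * (Real.exp (-(s * 1)) * ‖T.toFun 1‖ * ‖x‖))) := by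
          refine (C.le_opNorm _).trans ?_
          gcongr
          rw [norm_smul, Complex.norm_real, Real.norm_of_nonneg hs0]
          gcongr
          exact ((res A (s : ℂ)).le_of_opNorm_le e1 _).trans (by gcongr)
      _ = _ := by ring
  have h4 := (h2.add h1).add h3
  rw [zero_add, add_zero] at h4
  refine h4.congr' ?_
  filter_upwards [eventually_norm_rescale_le T] with s hs
  have hs' : (s : ℂ) ∈ rho A := hA.mem_rho (hs.trans_lt (by norm_num))
  have e1 := res_eq hs' (hA.sub_op_laplaceDom s x)
  rw [map_sub] at e1
  have e2 : res A (s : ℂ) x = hA.laplaceDom s x + res A (s : ℂ) ((T.rescale s).toFun 1 x) := by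
    rw [← e1]; abel
  have hint : IntervalIntegrable (fun t => (s * Real.exp (-(s * t))) • hA.avgDom t x) volume 0 1 := by
    have := hA.continuous_avgDom x
    exact Continuous.intervalIntegrable (by fun_prop) _ _
  have hstep : ∀ t, s • C ((s * Real.exp (-(s * t))) • hA.avgDom t x) =
      (s ^ 2 * Real.exp (-(s * t))) • C (hA.avgDom t x) := by
    intro t
    rw [← Complex.coe_smul (s * _), map_smul, Complex.coe_smul, smul_smul]
    congr 1
    ring
  rw [e2, smul_add, _root_.map_add]
  congr 1
  rw [map_smul, Complex.coe_smul, hA.laplaceDom_eq, _root_.map_add, ← C.intervalIntegral_comp_comm hint,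
    smul_add, ← intervalIntegral.integral_smul]
  simp only [hstep]
  congr 1
  rw [← Complex.coe_smul (Real.exp (-s)), map_smul, Complex.coe_smul, smul_smul, pow_one, mul_one]

/-- For d ∈ D(A) the averages converge to d in the graph norm, so C may be applied to the limit. -/
lemma isLambdaLimit_incl (hA : T.IsGenerator A) (C : GraphDomain A →L[ℂ] Y) (d : GraphDomain A) :
    IsLambdaLimit A C (GraphDomain.incl A d) (C d) := by
  refine hA.isLambdaLimit_of_tendsto C ?_
  have : Tendsto (fun t : ℝ => (t : ℂ)⁻¹ • hA.avgDom t (GraphDomain.incl A d)) (𝓝[>] 0) (𝓝 d) := by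
    rw [GraphDomain.tendsto_iff]
    constructor
    · have := tendsto_inv_smul_of_hasDerivAt (T.hasDerivAt_avg 0 (GraphDomain.incl A d))
      simpa [T.apply_zero] using this
    · have := (hA _ _).1 d.mem_graph
      simpa using this
  refine ((C.continuous.tendsto _).comp this).congr fun t => ?_
  simp

end C0Group.IsGenerator

lemma IsLambdaLimit.exists_eq {Y : Type*} [NormedAddCommGroup Y] [InnerProductSpace ℂ Y]
    {C : GraphDomain A →L[ℂ] Y} {x : E} {y : Y} (h : IsLambdaLimit A C x y) :
    ∃ hx : x ∈ (lambdaExt A C).domain, lambdaExt A C ⟨x, hx⟩ = y :=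
  ⟨⟨y, h⟩, tendsto_nhds_unique (lambdaExt_spec A C ⟨x, ⟨y, h⟩⟩) h⟩

end LambdaLimits

/-! ### Construction of the observability map -/

section ObservabilityMap

/-- The integral `∫₀ˣ g` as a bounded functional of `g ∈ L²([0,α]; U)`. -/
def primitiveAt {α : ℝ} {U : Type*} [NormedAddCommGroup U] [InnerProductSpace ℂ U]
    [CompleteSpace U] [Fact (0 < α)] {x : ℝ} (hx : x ∈ Icc 0 α) : L2 α U →L[ℂ] U :=
  LinearMap.mkContinuous
    { toFun := fun g => ∫ t in (0 : ℝ)..x, g t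
      map_add' := fun g g' => by
        have h0 : (0 : ℝ) ∈ Icc 0 α := ⟨le_rfl, (Fact.out : 0 < α).le⟩
        rw [primitive_congr (Lp.coeFn_add g g') hx]
        exact intervalIntegral.integral_add (intervalIntegrable_L2 g h0 hx)
          (intervalIntegrable_L2 g' h0 hx)
      map_smul' := fun a g => by
        rw [primitive_congr (Lp.coeFn_smul a g) hx]
        exact intervalIntegral.integral_smul a _ }
    √α (fun g => (norm_integral_le g hx).trans (integral_norm_le g))

lemma primitiveAt_apply {α : ℝ} {U : Type*} [NormedAddCommGroup U] [InnerProductSpace ℂ U]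
    [CompleteSpace U] [Fact (0 < α)] {x : ℝ} (hx : x ∈ Icc 0 α) (g : L2 α U) :
    primitiveAt hx g = ∫ t in (0 : ℝ)..x, g t := rfl

variable {Z Y : Type*} [NormedAddCommGroup Z] [InnerProductSpace ℂ Z] [CompleteSpace Z]
  [NormedAddCommGroup Y] [InnerProductSpace ℂ Y] [CompleteSpace Y]
  {T : C0Group Z} {A : Z →ₗ.[ℂ] Z} {C : GraphDomain A →L[ℂ] Y}

/-- Since T is a group, a backward orbit over an interval of length τ is a forward orbit started at
T(-c) d. Finitely many such intervals cover [0,μ]. -/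
lemma IsAdmissible.exists_lintegral_backward_le {hA : T.IsGenerator A} (hC : IsAdmissible hA C)
    (μ : ℝ) : ∃ K : ℝ≥0, ∀ d : GraphDomain A,
      ∫⁻ x in Icc 0 μ, ‖C (hA.orbit (-x) d)‖ₑ ^ 2 ≤ K * ‖GraphDomain.incl A d‖ₑ ^ 2 := by
  obtain ⟨τ, hτ, M, hM⟩ := hC
  have step : ∀ n : ℕ, ∃ K : ℝ≥0, ∀ d : GraphDomain A,
      ∫⁻ x in Icc 0 (n * τ), ‖C (hA.orbit (-x) d)‖ₑ ^ 2 ≤ K * ‖GraphDomain.incl A d‖ₑ ^ 2 := by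
    intro n
    induction n with
    | zero => exact ⟨0, fun d => by simp⟩
    | succ n ih =>
      obtain ⟨K, hK⟩ := ih
      set c : ℝ := (n + 1 : ℕ) * τ with hc
      -- On the last interval substitute x = c - t, so that T(-x) d = T(t) T(-c) d, and use
      -- admissibility at T(-c) d.
      refine ⟨K + M * ‖T.toFun (-c)‖₊ ^ 2, fun d => ?_⟩
      have hsub : Icc 0 c ⊆ Icc 0 (n * τ) ∪ Icc (c - τ) c := by
        intro x hx
        rcases le_total x (n * τ) with h | h
        · exact Or.inl ⟨hx.1, h⟩
        · refine Or.inr ⟨?_, hx.2⟩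
          rw [hc]; push_cast; linarith
      have hpres : MeasurePreserving (fun t : ℝ => c - t) volume volume :=
        Measure.measurePreserving_sub_left volume c
      have hcv := hpres.setLIntegral_comp_preimage_emb (MeasurableEquiv.subLeft c).measurableEmbedding
        (fun x => ‖C (hA.orbit (-x) d)‖ₑ ^ 2) (Icc (c - τ) c)
      have hpre : (fun t : ℝ => c - t) ⁻¹' Icc (c - τ) c = Icc 0 τ := by
        ext t
        simp only [mem_preimage, mem_Icc]
        constructor <;> rintro ⟨h1, h2⟩ <;> constructor <;> linarith
      have horb : ∀ t, hA.orbit (-(c - t)) d = hA.orbit t (hA.orbit (-c) d) := by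
        intro t
        refine GraphDomain.incl_injective ?_
        rw [hA.incl_orbit, hA.incl_orbit, hA.incl_orbit, ← T.apply_add]
        congr 2
        ring
      rw [hpre] at hcv
      simp only [horb] at hcv
      calc ∫⁻ x in Icc 0 c, ‖C (hA.orbit (-x) d)‖ₑ ^ 2
          ≤ ∫⁻ x in Icc 0 (n * τ) ∪ Icc (c - τ) c, ‖C (hA.orbit (-x) d)‖ₑ ^ 2 :=
            lintegral_mono_set hsub
        _ ≤ _ := lintegral_union_le _ _ _
        _ ≤ K * ‖GraphDomain.incl A d‖ₑ ^ 2 +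
            M * (‖T.toFun (-c)‖ₑ * ‖GraphDomain.incl A d‖ₑ) ^ 2 := by
            refine add_le_add (hK d) ?_
            rw [← hcv]
            refine (hM _).trans ?_
            gcongr
            rw [hA.incl_orbit]
            exact (T.toFun (-c)).le_opENorm _
        _ = _ := by
            rw [enorm_eq_nnnorm (T.toFun (-c))]
            push_cast
            ring
  obtain ⟨n, hn⟩ := exists_nat_ge (μ / τ)
  obtain ⟨K, hK⟩ := step n
  refine ⟨K, fun d => (lintegral_mono_set (Icc_subset_Icc_right ?_)).trans (hK d)⟩
  exact (div_le_iff₀ hτ).1 hn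

variable {μ : ℝ} [hμ : Fact (0 < μ)]

lemma memLp_of_continuous {f : ℝ → Y} (hf : Continuous f) :
    MemLp f 2 (volume.restrict (Icc (0 : ℝ) μ)) := by
  obtain ⟨K, hK⟩ := isCompact_Icc.exists_bound_of_continuousOn (s := Icc (0 : ℝ) μ) hf.continuousOn
  refine MemLp.of_bound hf.aestronglyMeasurable K ?_
  filter_upwards [ae_restrict_mem measurableSet_Icc] with x hx using hK x hx

lemma continuous_backward (hA : T.IsGenerator A) (C : GraphDomain A →L[ℂ] Y) (d : GraphDomain A) :
    Continuous fun x : ℝ => -C (hA.orbit (-x) d) := by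
  have := (hA.continuous_orbit' d).comp continuous_neg
  exact (C.continuous.comp this).neg

variable (μ) in
/-- The observability map of `(-A, -C)` on `D(A)`. -/
def obsDom (hA : T.IsGenerator A) (C : GraphDomain A →L[ℂ] Y) : GraphDomain A →ₗ[ℂ] L2 μ Y where
  toFun d := (memLp_of_continuous (continuous_backward hA C d)).toLp _
  map_add' d d' := by
    rw [← MemLp.toLp_add]
    refine MemLp.toLp_congr _ _ (Eventually.of_forall fun x => ?_)
    have : hA.orbit (-x) (d + d') = hA.orbit (-x) d + hA.orbit (-x) d' :=
      GraphDomain.incl_injective (by simp [hA.incl_orbit])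
    simp only [Pi.add_apply, this, map_add, neg_add]
  map_smul' c d := by
    rw [RingHom.id_apply, ← MemLp.toLp_const_smul]
    refine MemLp.toLp_congr _ _ (Eventually.of_forall fun x => ?_)
    have : hA.orbit (-x) (c • d) = c • hA.orbit (-x) d :=
      GraphDomain.incl_injective (by simp [hA.incl_orbit])
    simp only [Pi.smul_apply, this, map_smul, smul_neg]

lemma norm_obsDom_le {hA : T.IsGenerator A} (hC : IsAdmissible hA C) :
    ∃ K : ℝ, ∀ d : GraphDomain A, ‖obsDom μ hA C d‖ ≤ K * ‖GraphDomain.incl A d‖ := by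
  obtain ⟨K, hK⟩ := hC.exists_lintegral_backward_le μ
  -- K bounds the squared norm; K ≤ (K + 1)² avoids a square root.
  refine ⟨(K + 1 : ℝ≥0), fun d => ?_⟩
  have hm := memLp_of_continuous (μ := μ) (continuous_backward hA C d)
  have h1 : eLpNorm (fun x : ℝ => -C (hA.orbit (-x) d)) 2 (volume.restrict (Icc (0 : ℝ) μ)) ^ 2 =
      ∫⁻ x in Icc 0 μ, ‖C (hA.orbit (-x) d)‖ₑ ^ 2 := by
    have := eLpNorm_nnreal_pow_eq_lintegral (p := 2) (f := fun x : ℝ => -C (hA.orbit (-x) d))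
      (μ := volume.restrict (Icc (0 : ℝ) μ)) two_ne_zero
    simpa using this
  have h2 : eLpNorm (fun x : ℝ => -C (hA.orbit (-x) d)) 2 (volume.restrict (Icc (0 : ℝ) μ)) ≤
      (K + 1 : ℝ≥0) * ‖GraphDomain.incl A d‖ₑ := by
    refine (ENNReal.pow_le_pow_left_iff two_ne_zero).1 ?_
    rw [h1, mul_pow]
    refine (hK d).trans ?_
    gcongr
    rw [← ENNReal.coe_pow, ENNReal.coe_le_coe]
    have : K ≤ K * K + 2 * K + 1 := by
      have : K ≤ 2 * K := by rw [two_mul]; exact le_self_add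
      calc K ≤ 2 * K := this
        _ ≤ K * K + 2 * K := le_add_self
        _ ≤ _ := le_self_add
    calc K ≤ K * K + 2 * K + 1 := this
      _ = _ := by ring
  change ‖hm.toLp _‖ ≤ _
  rw [Lp.norm_toLp]
  refine (ENNReal.toReal_mono (ENNReal.mul_ne_top ENNReal.coe_ne_top enorm_ne_top) h2).trans ?_
  rw [ENNReal.toReal_mul, toReal_enorm, ENNReal.coe_toReal]

variable (μ) in
/-- The bounded extension to `Z` of the observability map of `(-A, -C)`. -/
def obs (hA : T.IsGenerator A) (C : GraphDomain A →L[ℂ] Y) : Z →L[ℂ] L2 μ Y :=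
  (obsDom μ hA C).extendOfNorm (GraphDomain.incl A).toLinearMap

lemma obs_incl {hA : T.IsGenerator A} (hC : IsAdmissible hA C) (d : GraphDomain A) :
    obs μ hA C (GraphDomain.incl A d) = obsDom μ hA C d :=
  LinearMap.extendOfNorm_eq (e := (GraphDomain.incl A).toLinearMap) hA.denseRange_incl
    (norm_obsDom_le hC) d

lemma obs_incl_ae {hA : T.IsGenerator A} (hC : IsAdmissible hA C) (d : GraphDomain A) :
    obs μ hA C (GraphDomain.incl A d) =ᵐ[volume.restrict (Icc (0 : ℝ) μ)]
      fun x => -C (hA.orbit (-x) d) := by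
  rw [obs_incl hC]
  exact MemLp.coeFn_toLp (memLp_of_continuous (continuous_backward hA C d))

lemma avgDom_incl (hA : T.IsGenerator A) (t : ℝ) (d : GraphDomain A) :
    hA.avgDom t (GraphDomain.incl A d) = ∫ σ in (0 : ℝ)..t, hA.orbit σ d := by
  obtain ⟨r, hr⟩ := hA.rho_nonempty
  have := completeSpace_graphDomain hr
  refine GraphDomain.incl_injective ?_
  rw [← ContinuousLinearMap.intervalIntegral_comp_comm _
    ((hA.continuous_orbit' d).intervalIntegrable _ _)]
  rfl

/-- Both sides are bounded in z and agree on the dense subspace D(A). The right side is defined on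
all of Z, because orbit integrals lie in D(A). -/
lemma integral_obs {hA : T.IsGenerator A} (hC : IsAdmissible hA C) {x : ℝ} (hx : x ∈ Icc 0 μ)
    (z : Z) : ∫ t in (0 : ℝ)..x, obs μ hA C z t = C (hA.avgDom (-x) z) := by
  obtain ⟨r, hr⟩ := hA.rho_nonempty
  have := completeSpace_graphDomain hr
  have key : ⇑((primitiveAt hx).comp (obs μ hA C)) = ⇑(C.comp (hA.avgDom (-x))) := by
    refine hA.denseRange_incl.equalizer (ContinuousLinearMap.continuous _)
      (ContinuousLinearMap.continuous _) (funext fun d => ?_)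
    change primitiveAt hx (obs μ hA C (GraphDomain.incl A d)) =
      C (hA.avgDom (-x) (GraphDomain.incl A d))
    rw [primitiveAt_apply, primitive_congr (obs_incl_ae hC d) hx, avgDom_incl,
      ← C.intervalIntegral_comp_comm ((hA.continuous_orbit' d).intervalIntegrable _ _),
      intervalIntegral.integral_neg, intervalIntegral.integral_comp_neg (fun σ => C (hA.orbit σ d)),
      neg_zero, ← intervalIntegral.integral_symm]
  exact congrFun key z

/-- By Lebesgue differentiation, C ∫₀^{-u} T(σ) z dσ has derivative (Ψ z)(x) at almost every u = x.
Its difference quotients are, after reflection, C applied to averages of the orbit of T(-x) z. -/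
lemma isObservabilityMap_obs {hA : T.IsGenerator A} (hC : IsAdmissible hA C) :
    IsObservabilityMap T A C μ (obs μ hA C) := by
  intro z
  have hμ0 := hμ.out
  have hint := intervalIntegrable_L2 (obs μ hA C z) (a := 0) (b := μ) ⟨le_rfl, hμ0.le⟩
    ⟨hμ0.le, le_rfl⟩
  have hd := hint.ae_hasDerivAt_integral
  have hne0 : ∀ᵐ x : ℝ, x ≠ 0 := by simp [ae_iff, measure_singleton]
  have hneμ : ∀ᵐ x : ℝ, x ≠ μ := by simp [ae_iff, measure_singleton]
  rw [ae_restrict_iff' measurableSet_Icc]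
  filter_upwards [hd, hne0, hneμ] with x hx h0 h1 hxm
  have hx' := hx (by rwa [uIcc_of_le hμ0.le]) 0 (by simp)
  have heq : (fun u => C (hA.avgDom (-u) z)) =ᶠ[𝓝 x]
      fun u => ∫ t in (0 : ℝ)..u, obs μ hA C z t := by
    filter_upwards [Icc_mem_nhds (lt_of_le_of_ne hxm.1 (Ne.symm h0)) (lt_of_le_of_ne hxm.2 h1)]
      with u hu
    exact (integral_obs hC hu z).symm
  have h2 := hx'.congr_of_eventuallyEq heq
  have h3 : HasDerivAt (fun t => C (hA.avgDom t z)) (-(obs μ hA C z x)) (-x) := by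
    rw [← neg_neg x] at h2
    have := HasDerivAt.scomp (-x) h2 (hasDerivAt_neg (-x))
    simpa [Function.comp_def] using this
  have h4 := C0Group.tendsto_inv_smul_of_hasDerivAt h3
  have h5 : IsLambdaLimit A C (T.toFun (-x) z) (-(obs μ hA C z x)) := by
    refine hA.isLambdaLimit_of_tendsto C (h4.congr fun t => ?_)
    rw [hA.avgDom_orbit, map_sub]
  obtain ⟨h6, h7⟩ := h5.exists_eq
  exact ⟨h6, by rw [h7, neg_neg]⟩

lemma integral_obs_op {hA : T.IsGenerator A} (hC : IsAdmissible hA C) {x : ℝ} (hx : x ∈ Icc 0 μ)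
    (d : GraphDomain A) :
    ∫ t in (0 : ℝ)..x, obs μ hA C (GraphDomain.op A d) t = C (hA.orbit (-x) d) - C d := by
  rw [integral_obs hC hx, hA.avgDom_op, map_sub]

lemma integral_neg_obs_op {hA : T.IsGenerator A} (hC : IsAdmissible hA C) {x : ℝ}
    (hx : x ∈ Icc 0 μ) (d : GraphDomain A) :
    ∫ t in (0 : ℝ)..x, (-obs μ hA C (GraphDomain.op A d)) t = C d - C (hA.orbit (-x) d) := by
  rw [primitive_congr (Lp.coeFn_neg _) hx]
  simp only [Pi.neg_apply]
  rw [intervalIntegral.integral_neg, integral_obs_op hC hx, neg_sub]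

/-- For `d ∈ D(A)` the function `Ψ d` lies in `H¹`, with `(Ψ d)' = -Ψ A d` and `(Ψ d)(0) = -C d`. -/
lemma isH1_obs {hA : T.IsGenerator A} (hC : IsAdmissible hA C) (d : GraphDomain A) :
    IsH1 (obs μ hA C (GraphDomain.incl A d)) (-obs μ hA C (GraphDomain.op A d)) (-C d) := by
  filter_upwards [obs_incl_ae hC d, ae_restrict_mem measurableSet_Icc] with x h hx
  rw [h, integral_neg_obs_op hC hx]
  abel

end ObservabilityMap

/-! ### The extrapolation space and its resolvent -/

section Extrapolation

variable {E : Type*} [NormedAddCommGroup E] [InnerProductSpace ℂ E] [CompleteSpace E]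
  {A : E →ₗ.[ℂ] E} {s : ℂ}

lemma inner_op_adjoint (hA : Dense (A.domain : Set E)) (v : GraphDomain A.adjoint)
    (d : GraphDomain A) :
    inner ℂ (GraphDomain.op A.adjoint v) (GraphDomain.incl A d) =
      inner ℂ (GraphDomain.incl A.adjoint v) (GraphDomain.op A d) :=
  LinearPMap.adjoint_isFormalAdjoint hA (v : A.adjoint.domain) (d : A.domain)

lemma mem_graph_adjoint (hA : Dense (A.domain : Set E)) {y w : E}
    (h : ∀ d : GraphDomain A, inner ℂ w (GraphDomain.incl A d) = inner ℂ y (GraphDomain.op A d)) :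
    (y, w) ∈ A.adjoint.graph := by
  have hy : y ∈ A.adjoint.domain := LinearPMap.mem_adjoint_domain_of_exists y ⟨w, fun d => h d⟩
  have := LinearPMap.adjoint_apply_eq hA ⟨y, hy⟩ (x₀ := w) (fun d => h d)
  rw [← this]
  exact LinearPMap.mem_graph _ ⟨y, hy⟩

lemma adjoint_res_mem_graph (hA : Dense (A.domain : Set E)) (hs : s ∈ rho A) (y : E) :
    (((GraphDomain.incl A).comp (res A s)).adjoint y,
      starRingEnd ℂ s • ((GraphDomain.incl A).comp (res A s)).adjoint y - y) ∈ A.adjoint.graph := by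
  refine mem_graph_adjoint hA fun d => ?_
  rw [inner_sub_left, inner_smul_left, Complex.conj_conj, ContinuousLinearMap.adjoint_inner_left,
    ContinuousLinearMap.adjoint_inner_left, ← inner_smul_right, ← inner_sub_right]
  congr 1
  have := congrArg (GraphDomain.incl A) (res_sub_op hs d)
  rw [map_sub, map_sub, map_smul, map_smul] at this
  simp only [ContinuousLinearMap.comp_apply]
  exact sub_eq_iff_eq_add.2 (sub_eq_iff_eq_add'.1 this)

/-- The Hilbert adjoint of (s - A)⁻¹ takes values in D(A*) and inverts s̄ - A* there. -/
lemma exists_adjoint_resolvent (hA : Dense (A.domain : Set E)) (hs : s ∈ rho A) :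
    ∃ S : E →L[ℂ] GraphDomain A.adjoint,
      (∀ y, starRingEnd ℂ s • GraphDomain.incl A.adjoint (S y) - GraphDomain.op A.adjoint (S y) =
        y) ∧
      (∀ v, S (starRingEnd ℂ s • GraphDomain.incl A.adjoint v - GraphDomain.op A.adjoint v) =
        v) := by
  let S : E →L[ℂ] GraphDomain A.adjoint := GraphDomain.lift _
    (starRingEnd ℂ s • ((GraphDomain.incl A).comp (res A s)).adjoint - ContinuousLinearMap.id ℂ E)
    (adjoint_res_mem_graph hA hs)
  have hincl : ∀ y, GraphDomain.incl A.adjoint (S y) =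
    ((GraphDomain.incl A).comp (res A s)).adjoint y := fun _ => rfl
  have hop : ∀ y, GraphDomain.op A.adjoint (S y) =
      starRingEnd ℂ s • ((GraphDomain.incl A).comp (res A s)).adjoint y - y :=
    fun y => GraphDomain.op_lift _ _ _ y
  refine ⟨S, fun y => ?_, fun v => ?_⟩
  · rw [hop, hincl]
    exact sub_sub_cancel _ _
  · refine GraphDomain.incl_injective (ext_inner_right ℂ fun x => ?_)
    rw [hincl, ContinuousLinearMap.adjoint_inner_left, inner_sub_left,
      inner_smul_left, Complex.conj_conj, ContinuousLinearMap.comp_apply, inner_op_adjoint hA,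
      ← inner_smul_right, ← inner_sub_right, sub_op_res hs]

lemma smul_toExtrap_sub_extOp_apply (s : ℂ) (x : E) (v : GraphDomain A.adjoint) :
    (s • toExtrap A - extOp A) x v = inner ℂ
      (starRingEnd ℂ s • GraphDomain.incl A.adjoint v - GraphDomain.op A.adjoint v) x := by
  rw [inner_sub_left, inner_smul_left, Complex.conj_conj]
  rfl

/-- The operator s - Ã is dual to s̄ - A* : D(A*) → E, which is bijective; the Riesz theorem gives
surjectivity. -/
lemma isInvertible_extrap (hA : Dense (A.domain : Set E)) (hs : s ∈ rho A) :
    (s • toExtrap A - extOp A).IsInvertible := by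
  obtain ⟨S, hS1, hS2⟩ := exists_adjoint_resolvent hA hs
  have hinj : LinearMap.ker (s • toExtrap A - extOp A).toLinearMap = ⊥ := by
    rw [LinearMap.ker_eq_bot']
    intro x hx
    refine ext_inner_left ℂ fun y => ?_
    have := DFunLike.congr_fun hx (S y)
    rw [ContinuousLinearMap.coe_coe, smul_toExtrap_sub_extOp_apply, hS1] at this
    rw [this, inner_zero_right]
    rfl
  have hsurj : LinearMap.range (s • toExtrap A - extOp A).toLinearMap = ⊤ := by
    rw [LinearMap.range_eq_top]
    intro φ
    -- Functionals in the extrapolation space are antilinear; conjugation makes φ ∘ S linear, as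
    -- Riesz requires.
    let ℓ : E →L[ℂ] ℂ := (starL ℂ : ℂ ≃L⋆[ℂ] ℂ).toContinuousLinearMap.comp (φ.comp S)
    refine ⟨(InnerProductSpace.toDual ℂ E).symm ℓ, ?_⟩
    ext v
    rw [ContinuousLinearMap.coe_coe, smul_toExtrap_sub_extOp_apply, ← inner_conj_symm,
      InnerProductSpace.toDual_symm_apply]
    change starRingEnd ℂ (starRingEnd ℂ (φ (S _))) = φ v
    rw [Complex.conj_conj, hS2]
  exact ⟨ContinuousLinearEquiv.ofBijective _ hinj hsurj,
    ContinuousLinearEquiv.coe_ofBijective _ hinj hsurj⟩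

lemma extRes_eq (hA : Dense (A.domain : Set E)) (hs : s ∈ rho A) {φ : Extrap A} {z : E}
    (h : s • toExtrap A z - extOp A z = φ) : extRes A s φ = z :=
  (isInvertible_extrap hA hs).inverse_apply_eq.2 h.symm

lemma sub_extRes (hA : Dense (A.domain : Set E)) (hs : s ∈ rho A) (φ : Extrap A) :
    s • toExtrap A (extRes A s φ) - extOp A (extRes A s φ) = φ :=
  ((isInvertible_extrap hA hs).inverse_apply_eq.1 (rfl : extRes A s φ = extRes A s φ)).symm

lemma extOp_incl (hA : Dense (A.domain : Set E)) (d : GraphDomain A) :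
    extOp A (GraphDomain.incl A d) = toExtrap A (GraphDomain.op A d) := by
  ext v
  exact inner_op_adjoint hA v d

lemma extRes_toExtrap (hA : Dense (A.domain : Set E)) (hs : s ∈ rho A) (z : E) :
    extRes A s (toExtrap A z) = GraphDomain.incl A (res A s z) := by
  refine extRes_eq hA hs ?_
  rw [extOp_incl hA, ← map_smul, ← map_sub, sub_op_res hs]

/-- The resolvent identity on the extrapolation space. -/
lemma extRes_sub_extRes (hA : Dense (A.domain : Set E)) {r : ℂ} (hs : s ∈ rho A) (hr : r ∈ rho A)
    (φ : Extrap A) : extRes A s φ - extRes A r φ =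
      GraphDomain.incl A (res A s ((r - s) • extRes A r φ)) := by
  rw [← extRes_toExtrap hA hs]
  rw [sub_eq_iff_eq_add]
  refine extRes_eq hA hs ?_
  rw [map_add, map_add, smul_add, add_sub_add_comm, sub_extRes hA hs, sub_smul, map_sub, map_smul,
    map_smul, sub_add_sub_cancel, sub_extRes hA hr]

variable {Y : Type*} [NormedAddCommGroup Y] [InnerProductSpace ℂ Y] {F : Y →L[ℂ] Extrap A}

lemma domain_le_zSpace (hA : Dense (A.domain : Set E)) : A.domain ≤ zSpace A F := by
  intro z hz
  refine ⟨0, A ⟨z, hz⟩, ?_⟩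
  rw [map_zero, add_zero]
  exact extOp_incl hA (⟨z, hz⟩ : A.domain)

/-- If Ã z + F y = w ∈ Z, then (s - Ã) z = (s z - w) + F y. Apply the resolvent, which sends Z into
D(A). -/
lemma zSpace_eq (hA : Dense (A.domain : Set E)) (hs : s ∈ rho A) :
    zSpace A F = A.domain ⊔ LinearMap.range ((extRes A s).comp F).toLinearMap := by
  apply le_antisymm
  · rintro z ⟨y, w, h⟩
    have hz : z = GraphDomain.incl A (res A s (s • z - w)) + extRes A s (F y) := by
      rw [← extRes_toExtrap hA hs, ← map_add]
      refine (extRes_eq hA hs ?_).symm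
      rw [map_sub, map_smul, ← h]
      abel
    rw [hz]
    exact Submodule.add_mem_sup (GraphDomain.incl_mem _) ⟨y, rfl⟩
  · rw [sup_le_iff]
    constructor
    · exact domain_le_zSpace hA
    · rintro _ ⟨y, rfl⟩
      refine ⟨y, s • extRes A s (F y), ?_⟩
      change extOp A (extRes A s (F y)) + F y = _
      nth_rw 2 [← sub_extRes hA hs (F y)]
      rw [map_smul]
      abel

lemma extRes_mem_zSpace (hA : Dense (A.domain : Set E)) (hs : s ∈ rho A) {φ : Extrap A}
    (hφ : φ ∈ sumSpace A F) : extRes A s φ ∈ zSpace A F := by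
  obtain ⟨_, ⟨z, rfl⟩, _, ⟨y, rfl⟩, rfl⟩ := Submodule.mem_sup.1 hφ
  rw [zSpace_eq hA hs, map_add]
  refine Submodule.add_mem_sup ?_ ⟨y, rfl⟩
  rw [ContinuousLinearMap.coe_coe, extRes_toExtrap hA hs]
  exact GraphDomain.incl_mem _

lemma toExtrap_mem_sumSpace (z : E) : toExtrap A z ∈ sumSpace A F :=
  Submodule.mem_sup_left ⟨z, rfl⟩

lemma extOp_mem_sumSpace {z : E} (hz : z ∈ zSpace A F) : extOp A z ∈ sumSpace A F := by
  obtain ⟨y, w, h⟩ := hz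
  rw [eq_sub_of_add_eq h]
  exact Submodule.sub_mem _ (toExtrap_mem_sumSpace w) (Submodule.mem_sup_right ⟨y, rfl⟩)

end Extrapolation

/-! ### Invertibility of coercive operators -/

section Coercive

variable {H : Type*} [NormedAddCommGroup H] [InnerProductSpace ℂ H] [CompleteSpace H]

/-- A bounded operator `N` with `‖x‖² ≤ Re ⟨N x, x⟩` is invertible. -/
lemma isUnit_of_norm_sq_le_re_inner {N : H →L[ℂ] H}
    (h : ∀ x, ‖x‖ ^ 2 ≤ (inner ℂ (N x) x).re) : IsUnit N := by
  have hb : ∀ x, ‖x‖ ≤ ‖N x‖ := by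
    intro x
    have h1 := (h x).trans ((Complex.re_le_norm _).trans (norm_inner_le_norm (𝕜 := ℂ) (N x) x))
    rcases eq_or_lt_of_le (norm_nonneg x) with h0 | h0
    · rw [← h0]; exact norm_nonneg _
    · nlinarith
  have hanti : AntilipschitzWith 1 N := N.antilipschitz_of_bound (by simpa using hb)
  have hker : LinearMap.ker N.toLinearMap = ⊥ := LinearMap.ker_eq_bot.2 hanti.injective
  have hclosed : IsClosed (LinearMap.range N.toLinearMap : Set H) :=
    hanti.isClosed_range N.uniformContinuous
  -- The range is closed by the lower bound; a vector w orthogonal to it satisfies ⟨N w, w⟩ = 0, so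
  -- w = 0 by coercivity.
  have hrange : LinearMap.range N.toLinearMap = ⊤ := by
    have := hclosed.completeSpace_coe
    rw [← Submodule.orthogonal_eq_bot_iff, Submodule.eq_bot_iff]
    intro w hw
    have h1 := h w
    rw [hw (N w) ⟨w, rfl⟩, Complex.zero_re] at h1
    have h2 : ‖w‖ ^ 2 = 0 := le_antisymm h1 (by positivity)
    simpa using h2
  exact ⟨(ContinuousLinearEquiv.unitsEquiv ℂ H).symm (ContinuousLinearEquiv.ofBijective N hker hrange),
    rfl⟩

end Coercive

/-! ### Resolvent of the shift and the end trace -/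

section ShiftResolvent

variable {α : ℝ} {U : Type*} [NormedAddCommGroup U] [InnerProductSpace ℂ U] [CompleteSpace U]

lemma IsH1.ext {f f' g : L2 α U} {c : U} (h : IsH1 f g c) (h' : IsH1 f' g c) : f = f' := by
  refine Lp.ext ?_
  filter_upwards [h, h'] with x h1 h2
  rw [h1, h2]

variable [hα : Fact (0 < α)]

variable (α U) in
/-- The Volterra operator `(V g)(x) = ∫₀ˣ g` on `L²([0,α]; U)`. -/
def volterra : L2 α U →L[ℂ] L2 α U :=
  LinearMap.mkContinuousOfExistsBound
    { toFun := fun g => Classical.choose (exists_isH1 g 0)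
      map_add' := fun g g' => by
        have h := (Classical.choose_spec (exists_isH1 g 0)).add
          (Classical.choose_spec (exists_isH1 g' 0))
        rw [add_zero] at h
        exact (Classical.choose_spec (exists_isH1 (g + g') 0)).ext h
      map_smul' := fun a g => by
        have h := (Classical.choose_spec (exists_isH1 g 0)).smul a
        rw [smul_zero] at h
        exact (Classical.choose_spec (exists_isH1 (a • g) 0)).ext h }
    (by
      refine ⟨(measureUnivNNReal (volume.restrict (Icc (0 : ℝ) α)) : ℝ) ^ (2 : ℝ≥0∞).toReal⁻¹ * √α,
        fun g => ?_⟩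
      rw [mul_assoc]
      refine Lp.norm_le_of_ae_bound (by positivity) ?_
      filter_upwards [Classical.choose_spec (exists_isH1 g 0), ae_restrict_mem measurableSet_Icc]
        with x hx hxm
      change ‖(Classical.choose (exists_isH1 g 0) : L2 α U) x‖ ≤ _
      rw [hx, zero_add]
      exact (norm_integral_le g hxm).trans (integral_norm_le g))

lemma isH1_volterra (g : L2 α U) : IsH1 (volterra α U g) g 0 :=
  Classical.choose_spec (exists_isH1 g 0)

lemma volterra_mem_graph (g : L2 α U) : (volterra α U g, -g) ∈ (shiftGen α U).graph := by
  obtain ⟨h1, h2⟩ := (isH1_volterra g).mem_shiftGen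
  rw [← h2]
  exact LinearPMap.mem_graph _ ⟨_, h1⟩

variable (α U) in
/-- The Volterra operator as a bounded operator into `D(G_α)`. -/
def volterraDom : L2 α U →L[ℂ] GraphDomain (shiftGen α U) :=
  GraphDomain.lift (volterra α U) (-ContinuousLinearMap.id ℂ (L2 α U)) volterra_mem_graph

lemma incl_volterraDom (g : L2 α U) :
    GraphDomain.incl _ (volterraDom α U g) = volterra α U g := rfl

lemma op_volterraDom (g : L2 α U) : GraphDomain.op _ (volterraDom α U g) = -g :=
  GraphDomain.op_lift _ _ _ g

lemma exists_volterraDom_eq (d : GraphDomain (shiftGen α U)) : ∃ g, volterraDom α U g = d := by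
  obtain ⟨⟨F, hF1, hF2⟩, -⟩ := d.incl_mem
  refine ⟨GraphDomain.op _ F, GraphDomain.incl_injective ?_⟩
  have h1 := H1.isH1 F
  have h0 : H1.initVal F = 0 := hF1
  rw [h0] at h1
  rw [incl_volterraDom]
  exact ((isH1_volterra _).ext h1).trans hF2

lemma inner_of_isH1_zero {K : L2 α U} {c : U} (hK : IsH1 K 0 c) (g : L2 α U) :
    inner ℂ K g = inner ℂ c (∫ t in (0 : ℝ)..α, g t) := by
  have hg : Integrable g (volume.restrict (Icc (0 : ℝ) α)) := (Lp.memLp g).integrable (by norm_num)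
  rw [L2.inner_def, intervalIntegral.integral_of_le hα.out.le, ← integral_Icc_eq_integral_Ioc,
    ← integral_inner hg]
  refine integral_congr_ae ?_
  filter_upwards [hK, ae_restrict_mem measurableSet_Icc] with x hx hxm
  rw [hx, primitive_congr (Lp.coeFn_zero U 2 (volume.restrict (Icc (0 : ℝ) α))) hxm]
  simp

/-- This is the integral of d/dx ‖V g‖² = 2 Re ⟨V g, g⟩, obtained from the integration by parts
formula. It expresses both the dissipativity of the shift and the energy leaving at the end point.
-/
lemma two_mul_re_inner_volterra (g : L2 α U) :
    2 * (inner ℂ (volterra α U g) g).re = ‖∫ t in (0 : ℝ)..α, g t‖ ^ 2 := by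
  set c := ∫ t in (0 : ℝ)..α, g t with hc
  -- Adding the constant -c makes V g vanish at α, as `inner_primitive` requires.
  obtain ⟨K, hK⟩ := exists_isH1 (0 : L2 α U) (-c)
  have hW := (isH1_volterra g).add hK
  rw [add_zero, zero_add] at hW
  have h := inner_primitive hW (isH1_volterra g)
  rw [inner_add_left, inner_of_isH1_zero hK, ← hc, inner_neg_left, ← inner_conj_symm g,
    inner_self_eq_norm_sq_to_K] at h
  have h2 := congrArg Complex.re h
  simp only [Complex.add_re, Complex.neg_re, Complex.conj_re] at h2
  have h3 : (((‖c‖ : ℝ) : ℂ) ^ 2).re = ‖c‖ ^ 2 := by norm_cast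
  change _ + -((((‖c‖ : ℝ) : ℂ) ^ 2).re) = _ at h2
  rw [h3] at h2
  linarith

lemma sub_op_volterraDom (s : ℂ) (g : L2 α U) :
    s • GraphDomain.incl _ (volterraDom α U g) - GraphDomain.op _ (volterraDom α U g) =
      g + s • volterra α U g := by
  rw [incl_volterraDom, op_volterraDom, sub_neg_eq_add, add_comm]

lemma isUnit_one_add_smul_volterra {s : ℝ} (hs : 0 ≤ s) :
    IsUnit (1 + (s : ℂ) • volterra α U) := by
  refine isUnit_of_norm_sq_le_re_inner fun g => ?_
  change _ ≤ (inner ℂ (g + (s : ℂ) • volterra α U g) g).re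
  have h1 := two_mul_re_inner_volterra g
  have h2 : (inner ℂ g g).re = ‖g‖ ^ 2 := inner_self_eq_norm_sq (𝕜 := ℂ) g
  rw [inner_add_left, inner_smul_left, Complex.add_re, Complex.conj_ofReal, Complex.re_ofReal_mul, h2]
  have : 0 ≤ (inner ℂ (volterra α U g) g).re := by
    have := sq_nonneg ‖∫ t in (0 : ℝ)..α, g t‖
    linarith
  nlinarith

/-- Since D(G) is the range of V and (s - G) V = 1 + s V, it suffices to invert 1 + s V, which is
coercive for s ≥ 0. -/
lemma mem_rho_shiftGen {s : ℝ} (hs : 0 ≤ s) : (s : ℂ) ∈ rho (shiftGen α U) := by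
  obtain ⟨n, hn⟩ := isUnit_one_add_smul_volterra (α := α) (U := U) hs
  have hL : ∀ g, (s : ℂ) • GraphDomain.incl _ (volterraDom α U g) -
      GraphDomain.op _ (volterraDom α U g) = (n : L2 α U →L[ℂ] L2 α U) g := by
    intro g
    rw [sub_op_volterraDom, hn]
    rfl
  refine ContinuousLinearMap.IsInvertible.of_inverse
    (g := (volterraDom α U).comp (↑n⁻¹ : L2 α U →L[ℂ] L2 α U)) ?_ ?_
  · ext1 g
    refine (hL _).trans ?_
    exact DFunLike.congr_fun n.mul_inv g
  · ext1 d
    obtain ⟨g, rfl⟩ := exists_volterraDom_eq d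
    change volterraDom α U ((↑n⁻¹ : L2 α U →L[ℂ] L2 α U) ((s : ℂ) • GraphDomain.incl _
      (volterraDom α U g) - GraphDomain.op _ (volterraDom α U g))) = volterraDom α U g
    rw [hL]
    exact congrArg _ (DFunLike.congr_fun n.inv_mul g)

lemma traceC_volterraDom (g : L2 α U) :
    traceC α U (volterraDom α U g) = ∫ t in (0 : ℝ)..α, g t := by
  set F : H1 α U := genToH1 α U (volterraDom α U g)
  have h := F.isH1.unique (show IsH1 (GraphDomain.incl _ F) g 0 from isH1_volterra g)
  change F.initVal + (∫ t in (0 : ℝ)..α, (GraphDomain.op (deriv1 α U) F) t) = _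
  rw [h.1, h.2, zero_add]

/-- Dissipativity of the shift controls the end value of the resolvent. -/
lemma norm_traceC_res_le {s : ℝ} (hs : 0 < s) (g : L2 α U) :
    ‖traceC α U (res (shiftGen α U) (s : ℂ) g)‖ ^ 2 ≤ ‖g‖ ^ 2 / (2 * s) := by
  obtain ⟨h, hh⟩ := exists_volterraDom_eq (res (shiftGen α U) (s : ℂ) g)
  have h1 := sub_op_res (mem_rho_shiftGen hs.le) g
  rw [← hh, sub_op_volterraDom] at h1
  rw [← hh, traceC_volterraDom, ← two_mul_re_inner_volterra]
  set v := volterra α U h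
  have h2 : (inner ℂ v g).re = (inner ℂ v h).re + s * ‖v‖ ^ 2 := by
    have h3 : (inner ℂ v v).re = ‖v‖ ^ 2 := inner_self_eq_norm_sq (𝕜 := ℂ) v
    rw [← h1, inner_add_right, inner_smul_right, Complex.add_re, Complex.re_ofReal_mul, h3]
  have h4 : (inner ℂ v g).re ≤ ‖v‖ * ‖g‖ := (Complex.re_le_norm _).trans (norm_inner_le_norm v g)
  rw [le_div_iff₀ (by positivity)]
  -- Completing the square: 4s(‖v‖‖g‖ - s‖v‖²) ≤ ‖g‖².
  nlinarith [sq_nonneg (2 * s * ‖v‖ - ‖g‖)]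

lemma tendsto_traceC_res (g : L2 α U) :
    Tendsto (fun s : ℝ => traceC α U (res (shiftGen α U) (s : ℂ) g)) atTop (𝓝 0) := by
  rw [tendsto_zero_iff_norm_tendsto_zero]
  have h1 : Tendsto (fun s : ℝ => √(‖g‖ ^ 2 / (2 * s))) atTop (𝓝 0) := by
    have : Tendsto (fun s : ℝ => ‖g‖ ^ 2 / (2 * s)) atTop (𝓝 0) :=
      tendsto_const_nhds.div_atTop (tendsto_id.const_mul_atTop two_pos)
    simpa using this.sqrt
  refine squeeze_zero' (Eventually.of_forall fun _ => norm_nonneg _) ?_ h1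
  filter_upwards [eventually_gt_atTop 0] with s hs
  exact Real.le_sqrt_of_sq_le (norm_traceC_res_le hs g)

/-- Here s (s - G)⁻¹ V g = V g - (s - G)⁻¹ g, and the end value of the last term tends to 0. -/
lemma isLambdaLimit_volterra (g : L2 α U) :
    IsLambdaLimit (shiftGen α U) (traceC α U) (volterra α U g) (∫ t in (0 : ℝ)..α, g t) := by
  have h := (tendsto_traceC_res g).const_sub (∫ t in (0 : ℝ)..α, g t)
  rw [sub_zero] at h
  refine h.congr' ?_
  filter_upwards [eventually_ge_atTop 0] with s hs
  have h1 := res_sub_op (mem_rho_shiftGen hs) (volterraDom α U g)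
  rw [sub_op_volterraDom, map_add, map_smul, add_comm] at h1
  rw [eq_sub_of_add_eq h1, map_sub, traceC_volterraDom]

lemma integral_exp_smul (s x : ℝ) (c : U) :
    s • ∫ t in (0 : ℝ)..x, Real.exp (-(s * t)) • c = c - Real.exp (-(s * x)) • c := by
  have hd : ∀ t : ℝ, HasDerivAt (fun t => -(Real.exp (-(s * t)) • c))
      (s • (Real.exp (-(s * t)) • c)) t := by
    intro t
    have h0 : HasDerivAt (fun t : ℝ => s * t) s t := by
      simpa using (hasDerivAt_id t).const_mul s
    refine (h0.neg.exp.smul_const c).neg.congr_deriv ?_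
    rw [← neg_smul, smul_smul]
    congr 1
    simp only [Pi.neg_apply]
    ring
  rw [← intervalIntegral.integral_smul, intervalIntegral.integral_eq_sub_of_hasDerivAt
    (fun t _ => hd t) (Continuous.intervalIntegrable (by fun_prop) _ _)]
  simp
  abel

/-- The function g = e^{-st} c solves g + s V g = c, so (s - G)⁻¹ c = V g, and s times its end value
is (1 - e^{-sα}) c. -/
lemma isLambdaLimit_const {K : L2 α U} {c : U} (hK : IsH1 K 0 c) :
    IsLambdaLimit (shiftGen α U) (traceC α U) K c := by
  have h := ((tendsto_pow_mul_exp_neg_mul 0 hα.out).smul_const c).const_sub c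
  simp only [pow_zero, one_mul, zero_smul, sub_zero] at h
  refine h.congr' ?_
  filter_upwards [eventually_ge_atTop 0] with s hs
  have hcont : Continuous fun t => Real.exp (-(s * t)) • c := by fun_prop
  have hm := memLp_of_continuous (μ := α) hcont
  set g : L2 α U := hm.toLp _
  have hg : g =ᵐ[volume.restrict (Icc (0 : ℝ) α)] fun t => Real.exp (-(s * t)) • c := hm.coeFn_toLp
  have hK' : g + (s : ℂ) • volterra α U g = K := by
    refine Lp.ext ?_
    filter_upwards [hK, hg, isH1_volterra g, Lp.coeFn_add g ((s : ℂ) • volterra α U g),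
      Lp.coeFn_smul (s : ℂ) (volterra α U g), ae_restrict_mem measurableSet_Icc]
      with x h1 h2 h3 h4 h5 hx
    rw [h4, Pi.add_apply, h5, Pi.smul_apply, h1, h2, h3, primitive_congr hg hx, zero_add,
      Complex.coe_smul, integral_exp_smul,
      primitive_congr (Lp.coeFn_zero U 2 (volume.restrict (Icc (0 : ℝ) α))) hx]
    simp
  have h1 := res_eq (mem_rho_shiftGen hs) ((sub_op_volterraDom (s : ℂ) g).trans hK')
  rw [h1, map_smul, traceC_volterraDom, primitive_congr hg ⟨hα.out.le, le_rfl⟩, Complex.coe_smul,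
    integral_exp_smul]

/-- The Λ-extension of `f ↦ f(α)` from `D(G_α)` still evaluates `H¹` functions at `α`. -/
lemma IsH1.isLambdaLimit {f g : L2 α U} {c : U} (h : IsH1 f g c) :
    IsLambdaLimit (shiftGen α U) (traceC α U) f (c + ∫ t in (0 : ℝ)..α, g t) := by
  obtain ⟨K, hK⟩ := exists_isH1 (0 : L2 α U) c
  have h1 := hK.add (isH1_volterra g)
  rw [zero_add, add_zero] at h1
  rw [h.ext h1]
  exact ((isLambdaLimit_const hK).add (isLambdaLimit_volterra g)).congr fun s => by simp

end ShiftResolvent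

/-! ### The Sylvester identity and the extension P -/

section Sylvester

variable {α : ℝ} {U : Type*} [NormedAddCommGroup U] [InnerProductSpace ℂ U] [CompleteSpace U]
  [hα : Fact (0 < α)]

/-- The extension of `G_α` on an `H¹` function with value `c` at `0`. -/
lemma IsH1.extOp_shiftGen {f g : L2 α U} {c : U} (h : IsH1 f g c) :
    extOp (shiftGen α U) f = toExtrap (shiftGen α U) (-g) - deltaB α U c := by
  ext v
  set w := GraphDomain.incl (shiftGen α U).adjoint v with hw
  set k := GraphDomain.op (shiftGen α U).adjoint v with hk
  have hv : IsH1 w k (-∫ t in (0 : ℝ)..α, k t) := adjoint_isH1 (v : (shiftGen α U).adjoint.domain)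
  -- Subtracting the constant c makes f vanish at 0; the pairing of that constant with v' = G* v
  -- produces the boundary term at 0.
  obtain ⟨K, hK⟩ := exists_isH1 (0 : L2 α U) (-c)
  have hf := h.add hK
  rw [add_zero, add_neg_cancel] at hf
  have h1 := inner_primitive hv hf
  have h2 := inner_of_isH1_zero hK k
  have h3 : trace0 α U (adjointToH1 α U v) = -∫ t in (0 : ℝ)..α, k t :=
    ((adjointToH1 α U v).isH1.unique hv).2
  change inner ℂ k f = inner ℂ w (-g) - inner ℂ (trace0 α U (adjointToH1 α U v)) c
  rw [h3, inner_neg_right, h1, inner_add_right, neg_neg, inner_neg_left, sub_neg_eq_add,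
    ← inner_conj_symm k K, h2, inner_conj_symm, inner_neg_right]
  abel

variable {Z Y : Type*} [NormedAddCommGroup Z] [InnerProductSpace ℂ Z] [CompleteSpace Z]
  [NormedAddCommGroup Y] [InnerProductSpace ℂ Y] [CompleteSpace Y]
  {T : C0Group Z} {A : Z →ₗ.[ℂ] Z} {C : GraphDomain A →L[ℂ] Y} {μ : ℝ} [hμ : Fact (0 < μ)]

/-- The initial value -C d of Ψ d contributes -B C d to (s - G̃) Ψ d, which the first summand
cancels. -/
lemma deltaB_add_obs {hA : T.IsGenerator A} (hC : IsAdmissible hA C) (s : ℂ) (d : GraphDomain A) :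
    deltaB μ Y (C d) + (s • toExtrap (shiftGen μ Y) (obs μ hA C (GraphDomain.incl A d)) -
      extOp (shiftGen μ Y) (obs μ hA C (GraphDomain.incl A d))) =
    toExtrap (shiftGen μ Y)
      (obs μ hA C (s • GraphDomain.incl A d - GraphDomain.op A d)) := by
  rw [(isH1_obs hC d).extOp_shiftGen, neg_neg, map_neg, map_sub, map_sub, map_smul, map_smul]
  abel

lemma C0Group.IsGenerator.exists_lambdaExt_eq (hA : T.IsGenerator A) (C : GraphDomain A →L[ℂ] Y)
    (d : GraphDomain A) : ∃ h : GraphDomain.incl A d ∈ (lambdaExt A C).domain,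
      lambdaExt A C ⟨GraphDomain.incl A d, h⟩ = C d :=
  (hA.isLambdaLimit_incl C d).exists_eq

/-- On D(A) the bracket acts as Ψ (s - A), and C_Λ extends C. The three algebraic properties of P
come from suitable splittings p = d + q. -/
lemma sylvester_value_add {hA : T.IsGenerator A} (hC : IsAdmissible hA C) (s : ℂ)
    {p q : Z} (d : GraphDomain A) (h : p = GraphDomain.incl A d + q)
    (hp : p ∈ (lambdaExt A C).domain) (hq : q ∈ (lambdaExt A C).domain) :
    deltaB μ Y (lambdaExt A C ⟨p, hp⟩) + (s • toExtrap (shiftGen μ Y) (obs μ hA C p) -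
      extOp (shiftGen μ Y) (obs μ hA C p)) =
    toExtrap (shiftGen μ Y) (obs μ hA C (s • GraphDomain.incl A d - GraphDomain.op A d)) +
    (deltaB μ Y (lambdaExt A C ⟨q, hq⟩) + (s • toExtrap (shiftGen μ Y) (obs μ hA C q) -
      extOp (shiftGen μ Y) (obs μ hA C q))) := by
  obtain ⟨hd, hCd⟩ := hA.exists_lambdaExt_eq C d
  have e : lambdaExt A C ⟨p, hp⟩ = C d + lambdaExt A C ⟨q, hq⟩ := by
    rw [← hCd, ← LinearPMap.map_add]
    congr 1
    exact Subtype.ext h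
  rw [← deltaB_add_obs hC, e, h, map_add, map_add, map_add, map_add, smul_add]
  abel

lemma extFormula_mk (Ψ : Z →L[ℂ] L2 μ Y) (s : ℂ) (φ : Extrap A)
    (hφ : φ ∈ (extFormula A C μ Ψ s).domain) (hφ' : extRes A s φ ∈ (lambdaExt A C).domain) :
    extFormula A C μ Ψ s ⟨φ, hφ⟩ = deltaB μ Y (lambdaExt A C ⟨extRes A s φ, hφ'⟩) +
      (s • toExtrap (shiftGen μ Y) (Ψ (extRes A s φ)) -
        extOp (shiftGen μ Y) (Ψ (extRes A s φ))) := rfl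

/-- The value of the formula for `P` does not depend on the point of the resolvent set. -/
lemma extFormula_eq {hA : T.IsGenerator A} (hC : IsAdmissible hA C) {s r : ℂ} (hs : s ∈ rho A)
    (hr : r ∈ rho A) (φ : Extrap A) (hφs : φ ∈ (extFormula A C μ (obs μ hA C) s).domain)
    (hφr : φ ∈ (extFormula A C μ (obs μ hA C) r).domain) :
    extFormula A C μ (obs μ hA C) s ⟨φ, hφs⟩ = extFormula A C μ (obs μ hA C) r ⟨φ, hφr⟩ := by
  have h := extRes_sub_extRes hA.dense_domain hs hr φ
  rw [extFormula_mk (obs μ hA C) s φ hφs hφs, extFormula_mk (obs μ hA C) r φ hφr hφr,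
    sylvester_value_add hC s _ (sub_eq_iff_eq_add.1 h) hφs hφr, sub_op_res hs, sub_smul, map_sub,
    map_sub, map_smul, map_smul, map_smul, map_smul]
  abel

lemma extFormula_toExtrap {hA : T.IsGenerator A} (hC : IsAdmissible hA C) {s : ℂ} (hs : s ∈ rho A)
    (z : Z) (hz : toExtrap A z ∈ (extFormula A C μ (obs μ hA C) s).domain) :
    extFormula A C μ (obs μ hA C) s ⟨toExtrap A z, hz⟩ =
      toExtrap (shiftGen μ Y) (obs μ hA C z) := by
  have h : extRes A s (toExtrap A z) = GraphDomain.incl A (res A s z) + 0 := by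
    rw [add_zero, extRes_toExtrap hA.dense_domain hs]
  rw [extFormula_mk (obs μ hA C) s (toExtrap A z) hz hz, sylvester_value_add hC s _ h hz (Submodule.zero_mem _), sub_op_res hs]
  have : lambdaExt A C ⟨0, Submodule.zero_mem _⟩ = 0 := LinearPMap.map_zero _
  rw [this, map_zero, map_zero, map_zero, map_zero, ← map_zero (toExtrap (shiftGen μ Y)),
    ← map_smul, smul_zero, map_zero, sub_zero, add_zero, add_zero]

/-- Split (s - Ã)⁻¹ Ã z as d - z with (s - A) d = s z. The bracket is then s Ψ z minus its value at
z, and the terms s Ψ z cancel. -/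
lemma extFormula_extOp {hA : T.IsGenerator A} (hC : IsAdmissible hA C) {s : ℂ} (hs : s ∈ rho A)
    (z : Z) (hz : z ∈ (lambdaExt A C).domain)
    (hAz : extOp A z ∈ (extFormula A C μ (obs μ hA C) s).domain) :
    extOp (shiftGen μ Y) (obs μ hA C z) - extFormula A C μ (obs μ hA C) s ⟨extOp A z, hAz⟩ =
      deltaB μ Y (lambdaExt A C ⟨z, hz⟩) := by
  have h : extRes A s (extOp A z) = GraphDomain.incl A (res A s (s • z)) + -z := by
    refine extRes_eq hA.dense_domain hs ?_
    rw [map_add, map_add, extOp_incl hA.dense_domain, smul_add, map_neg, map_neg, ← map_smul,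
      add_sub_add_comm, ← map_sub, sub_op_res hs, map_smul, smul_neg]
    abel
  have hneg : lambdaExt A C ⟨-z, Submodule.neg_mem _ hz⟩ = -lambdaExt A C ⟨z, hz⟩ :=
    LinearPMap.map_neg (lambdaExt A C) ⟨z, hz⟩
  rw [extFormula_mk (obs μ hA C) s (extOp A z) hAz hAz, sylvester_value_add hC s _ h hAz (Submodule.neg_mem _ hz), sub_op_res hs,
    hneg, map_neg, map_neg, map_neg, map_neg, map_smul, map_smul, smul_neg]
  abel

/-- For `d ∈ D(A)` the Λ-extension of `f ↦ f(μ)` maps `Ψ d` to `-C e^{-Aμ} d`. -/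
lemma isLambdaLimit_obs {hA : T.IsGenerator A} (hC : IsAdmissible hA C) (d : GraphDomain A) :
    IsLambdaLimit (shiftGen μ Y) (traceC μ Y) (obs μ hA C (GraphDomain.incl A d))
      (-C (hA.orbit (-μ) d)) := by
  have h := (isH1_obs (μ := μ) hC d).isLambdaLimit
  rw [integral_neg_obs_op hC ⟨hμ.out.le, le_rfl⟩] at h
  convert h using 1
  abel

/-- The operator `e^{At}` as a bounded operator on `D(A)`. -/
def C0Group.IsGenerator.orbitDom (hA : T.IsGenerator A) (t : ℝ) :
    GraphDomain A →L[ℂ] GraphDomain A :=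
  GraphDomain.lift ((T.toFun t).comp (GraphDomain.incl A)) ((T.toFun t).comp (GraphDomain.op A))
    (fun d => by
      have := (hA.orbit t d).mem_graph
      rwa [hA.op_orbit] at this)

end Sylvester

end

end DelaySylvester

/-! ### The main theorem -/

theorem mainTheorem5
    {Z Y : Type*} [NormedAddCommGroup Z] [InnerProductSpace ℂ Z] [CompleteSpace Z]
    [NormedAddCommGroup Y] [InnerProductSpace ℂ Y] [CompleteSpace Y]
    (T : DelaySylvester.C0Group Z) (A : Z →ₗ.[ℂ] Z) (hA : T.IsGenerator A)
    (C : DelaySylvester.GraphDomain A →L[ℂ] Y) (hC : DelaySylvester.IsAdmissible hA C)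
    (F₁ : Y →L[ℂ] DelaySylvester.Extrap A) (μ : ℝ) [Fact (0 < μ)] :
    open DelaySylvester in
    -- `ρ(A)` is nonempty and `Z_{F₁} = D(A) + (s - Ã)⁻¹ F₁ Y` for every `s ∈ ρ(A)`
    (rho A).Nonempty ∧
    (∀ s ∈ rho A, zSpace A F₁ = A.domain ⊔
      LinearMap.range ((extRes A s).comp F₁).toLinearMap) ∧
    (zSpace A F₁ ≤ (lambdaExt A C).domain →
      ∃ Ψ : Z →L[ℂ] L2 μ Y, IsObservabilityMap T A C μ Ψ ∧
      ∃ P : Extrap A →ₗ.[ℂ] Extrap (shiftGen μ Y),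
        -- (i) `P` is given by the formula for every `s ∈ ρ(A)`, and it extends `Ψ`
        (∀ s ∈ rho A, IsExtensionFor A C F₁ μ Ψ s P) ∧
        (∀ z : Z, ∃ hz : toExtrap A z ∈ P.domain,
          P ⟨toExtrap A z, hz⟩ = toExtrap (shiftGen μ Y) (Ψ z)) ∧
        -- (ii) the Sylvester equation; `f ∈ L²` is `P z`
        (∀ z ∈ zSpace A F₁, ∃ (hz : toExtrap A z ∈ P.domain) (hAz : extOp A z ∈ P.domain)
          (hCz : z ∈ (lambdaExt A C).domain) (f : L2 μ Y),
          P ⟨toExtrap A z, hz⟩ = toExtrap (shiftGen μ Y) f ∧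
          extOp (shiftGen μ Y) f - P ⟨extOp A z, hAz⟩ =
            deltaB μ Y (lambdaExt A C ⟨z, hCz⟩)) ∧
        -- (iii) `C_{μΛ} P = -C_Λ e^{-Aμ}` on `D(A)`, a bounded operator from `D(A)` to `Y`
        (∃ K : GraphDomain A →L[ℂ] Y, ∀ z : GraphDomain A,
          ∃ (hz : toExtrap A (GraphDomain.incl A z) ∈ P.domain) (f : L2 μ Y)
            (hf : f ∈ (lambdaExt (shiftGen μ Y) (traceC μ Y)).domain)
            (hCz : T.toFun (-μ) (GraphDomain.incl A z) ∈ (lambdaExt A C).domain),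
            P ⟨toExtrap A (GraphDomain.incl A z), hz⟩ = toExtrap (shiftGen μ Y) f ∧
            lambdaExt (shiftGen μ Y) (traceC μ Y) ⟨f, hf⟩ =
              -lambdaExt A C ⟨T.toFun (-μ) (GraphDomain.incl A z), hCz⟩ ∧
            K z = lambdaExt (shiftGen μ Y) (traceC μ Y) ⟨f, hf⟩)) := by
  open DelaySylvester in
  have hD := hA.dense_domain
  obtain ⟨r, hr⟩ := hA.rho_nonempty
  refine ⟨⟨r, hr⟩, fun s hs => zSpace_eq hD hs, fun hZ => ?_⟩
  -- The resolvent maps Z + F Y into Z_F, which lies in D(C_Λ) by assumption.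
  have hdom : ∀ s ∈ rho A, sumSpace A F₁ ≤ (extFormula A C μ (obs μ hA C) s).domain :=
    fun s hs φ hφ => hZ (extRes_mem_zSpace hD hs hφ)
  have hP : ∀ z, (extFormula A C μ (obs μ hA C) r).domRestrict (sumSpace A F₁)
      ⟨toExtrap A z, ⟨toExtrap_mem_sumSpace z, hdom r hr (toExtrap_mem_sumSpace z)⟩⟩ =
        toExtrap (shiftGen μ Y) (obs μ hA C z) :=
    fun z => extFormula_toExtrap hC hr z (hdom r hr (toExtrap_mem_sumSpace z))
  refine ⟨obs μ hA C, isObservabilityMap_obs hC,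
    (extFormula A C μ (obs μ hA C) r).domRestrict (sumSpace A F₁), ?_, fun z => ⟨_, hP z⟩, ?_, ?_⟩
  · intro s hs
    -- `domRestrict` intersects the two domains; by `hdom` the intersection is all of Z + F Y.
    refine ⟨inf_eq_left.2 (hdom r hr), ⟨fun φ hφ => hdom s hs hφ.1, ?_⟩⟩
    rintro ⟨φ, hφ⟩ ⟨_, hφs⟩ rfl
    exact (extFormula_eq hC hs hr φ hφs hφ.2).symm
  · intro z hz
    have hAz := extOp_mem_sumSpace hz
    exact ⟨_, ⟨hAz, hdom r hr hAz⟩, hZ hz, obs μ hA C z, hP z,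
      extFormula_extOp hC hr z (hZ hz) (hdom r hr hAz)⟩
  · refine ⟨-(C.comp (hA.orbitDom (-μ))), fun z => ?_⟩
    obtain ⟨hf, hf'⟩ := (isLambdaLimit_obs (μ := μ) hC z).exists_eq
    obtain ⟨hCz, hCz'⟩ := hA.exists_lambdaExt_eq C (hA.orbit (-μ) z)
    refine ⟨_, _, hf, hCz, hP _, ?_, ?_⟩
    · rw [hf', ← hCz']
      rfl
    · rw [hf']
      rfl
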